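/- Let $\mathbb R^\infty=\bigcup_{n\ge1}\mathbb R^n$. An additive BSS RAM without irrational constants has real registers $Z_1,Z_2,\dots$ and finitely many index registers $I_1,I_2,\dots$, and executes labelled instructions $Z_i:=Z_j+Z_k$, $Z_i:=Z_j-Z_k$, $Z_j:=0$, $Z_j:=1$, $Z_{I_j}:=Z_{I_k}$, $I_j:=1$, $I_j:=I_j+1$, "if $I_j=I_k$ then goto $l_1$ else goto $l_2$", together with tests on real registers. On input $(x_1,\dots,x_n)\in\mathbb R^\infty$ it starts with $Z_i=x_i$ for $i\le n$, with $0$ in the other real registers, and with $n$ in all index registers; when it stops, its output is $(Z_1,\dots,Z_{I_1})$. Let $\mathsf M^{1,=}_{\rm add}$ be the class of those machines whose only tests on real registers are equality tests "if $Z_j=0$ then goto $l_1$ else goto $l_2$", and $\mathsf M^{1}_{\rm add}$ the class of those whose only tests on real registers are order tests "if $Z_j\ge0$ then goto $l_1$ else goto $l_2$". For $\mathcal O\subseteq\mathbb R^\infty$, machines in $\mathsf M^1_{\rm add}(\mathcal O)$ may in addition to the instructions of $\mathsf M^1_{\rm add}$ use "if $(Z_1,\dots,Z_{I_1})\in\mathcal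 O$ then goto $l_1$ else goto $l_2$". For $\mathcal A,\mathcal B\subseteq\mathbb R^\infty$ write $\mathcal A\preceq\mathcal B$ if some machine in $\mathsf M^1_{\rm add}(\mathcal B)$ computes the characteristic function of $\mathcal A$, and $\mathcal A\precneqq\mathcal B$ if $\mathcal A\preceq\mathcal B$ and $\mathcal B\not\preceq\mathcal A$. Let ${\rm code}(\mathcal M)\in\{0,1\}^\infty$ be the concatenation of the codes of the symbols of the program of $\mathcal M$, each symbol being encoded unambiguously by a fixed number of bits. Write $(n\,.\,\vec x\,.\,\vec s)=(n,x_1,\dots,x_n,s_1,\dots,s_m)$, and put $$\mathbb H^{1,=}_{\rm add}=\bigcup_{n\ge1}\{(n\,.\,\vec x\,.\,{\rm code}(\mathcal M)) : \vec x\in\mathbb R^n,\ \mathcal M\in\mathsf M^{1,=}_{\rm add},\ \mathcal M\text{ halts on }\vec x\},$$ and define $\mathbb H^{1}_{\rm add}$ likewise with $\mathsf M^1_{\rm add}$ in place of $\mathsf M^{1,=}_{\rm add}$. Let $p_1=2,p_2=3,\dots$ be the prime numbers in increasing order. Then: 1. There is a machine in $\mathsf M^1_{\rm add}$ that semi-decides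 $\bigcup_{j\ge1}\{j\}\times(\mathbb R\setminus\{\sqrt{p_j}\})$, i.e. that computes the partial characteristic function of this set (output $1$ on the set, no halting outside it). 2. Let $\mathcal K\in\mathsf M^1_{\rm add}$ be any such machine, and for $i,j\ge1$ put $\mathbb P_j=\{(2\,.\,(j,x)\,.\,{\rm code}(\mathcal K)) : x\in\mathbb R\setminus\{\sqrt{p_j}\}\}$ and $\mathbb H_i=\mathbb H^{1,=}_{\rm add}\cup\mathbb P_1\cup\dots\cup\mathbb P_i$. Then for every $k\ge1$ $$\mathbb H^{1,=}_{\rm add}\precneqq\mathbb H_1\precneqq\cdots\precneqq\mathbb H_k\precneqq\mathbb H_{k+1}\precneqq\cdots\precneqq\bigcup_{i\ge1}\mathbb H_i\preceq\mathbb H^1_{\rm add}.$$ 3. In particular, $\mathbb H^{1,=}_{\rm add}\precneqq\mathbb H^{1}_{\rm add}$. -/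

import Mathlib

/-! Additive BSS RAMs over the reals with the constants 0 and 1, strong Turing reducibility, and the
halting problems for machines with equality tests and for machines with order tests. -/

namespace AddBSS

/-- Tuples of reals. The space `ℝ^∞ = ⋃_{n ≥ 1} ℝ^n` consists of the nonempty ones. -/
abbrev Tuple : Type := List ℝ

/-- Instructions of additive machines without irrational constants. Register numbers and labels are
counted from `0`: the arguments `i`, `j`, `k` stand for the registers `Z_{i+1}` or `I_{i+1}`, etc.,
and label `l` is the position of an instruction in the program. -/
inductive Instr : Type
  /-- `Z_i := Z_j + Z_k` -/
  | add (i j k : ℕ)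
  /-- `Z_i := Z_j - Z_k` -/
  | sub (i j k : ℕ)
  /-- `Z_j := 0` -/
  | setZero (j : ℕ)
  /-- `Z_j := 1` -/
  | setOne (j : ℕ)
  /-- `if Z_j = 0 then goto l₁ else goto l₂` -/
  | ifZero (j l₁ l₂ : ℕ)
  /-- `if Z_j ≥ 0 then goto l₁ else goto l₂` -/
  | ifNonneg (j l₁ l₂ : ℕ)
  /-- `Z_{I_j} := Z_{I_k}` -/
  | copy (j k : ℕ)
  /-- `I_j := 1` -/
  | idxOne (j : ℕ)
  /-- `I_j := I_j + 1` -/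
  | idxSucc (j : ℕ)
  /-- `if I_j = I_k then goto l₁ else goto l₂` -/
  | ifIdxEq (j k l₁ l₂ : ℕ)
  /-- `if (Z_1, …, Z_{I_1}) ∈ O then goto l₁ else goto l₂` -/
  | query (l₁ l₂ : ℕ)

/-- A machine is given by its program; the label following the last instruction, and every larger
label, means `stop`. -/
abbrev Machine : Type := List Instr

/-- A configuration: current label, contents of the index registers, contents of the real registers.
The contents of index registers are always positive. -/
structure Config : Type where
  pc : ℕ
  I : ℕ → ℕ
  Z : ℕ → ℝ

/-- The tuple `(Z_1, …, Z_{I_1})`, which is used for oracle queries and as output. -/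
def Config.tuple (s : Config) : Tuple := (List.range (s.I 0)).map s.Z

/-- The input procedure `Z_1 := x_1; …; Z_n := x_n; I_1 := n; I_2 := n; …`; the remaining real
registers contain `0`. -/
def start (x : Tuple) : Config where
  pc := 0
  I := fun _ => x.length
  Z := fun i => x.getD i 0

/-- Execution of one instruction with oracle `O`. Since real registers are counted from `0`, the
register `Z_{I_j}` is found at position `I_j - 1`. -/
noncomputable def Instr.exec (O : Set Tuple) (s : Config) : Instr → Config
  | .add i j k => { s with pc := s.pc + 1, Z := Function.update s.Z i (s.Z j + s.Z k) }
  | .sub i j k => { s with pc := s.pc + 1, Z := Function.update s.Z i (s.Z j - s.Z k) }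
  | .setZero j => { s with pc := s.pc + 1, Z := Function.update s.Z j 0 }
  | .setOne j => { s with pc := s.pc + 1, Z := Function.update s.Z j 1 }
  | .ifZero j l₁ l₂ => { s with pc := open Classical in if s.Z j = 0 then l₁ else l₂ }
  | .ifNonneg j l₁ l₂ => { s with pc := open Classical in if 0 ≤ s.Z j then l₁ else l₂ }
  | .copy j k => { s with
      pc := s.pc + 1
      Z := Function.update s.Z (s.I j - 1) (s.Z (s.I k - 1)) }
  | .idxOne j => { s with pc := s.pc + 1, I := Function.update s.I j 1 }
  | .idxSucc j => { s with pc := s.pc + 1, I := Function.update s.I j (s.I j + 1) }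
  | .ifIdxEq j k l₁ l₂ => { s with pc := if s.I j = s.I k then l₁ else l₂ }
  | .query l₁ l₂ => { s with pc := open Classical in if s.tuple ∈ O then l₁ else l₂ }

/-- One step of the machine `M` with oracle `O`; stopped configurations do not change. -/
noncomputable def step (M : Machine) (O : Set Tuple) (s : Config) : Config :=
  match M[s.pc]? with
  | none => s
  | some c => c.exec O s

/-- The configuration of `M` with oracle `O` on input `x` after `t` steps. -/
noncomputable def run (M : Machine) (O : Set Tuple) (x : Tuple) (t : ℕ) : Config :=
  (step M O)^[t] (start x)

/-- `M(x)↓`. -/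
def Halts (M : Machine) (O : Set Tuple) (x : Tuple) : Prop :=
  ∃ t, M.length ≤ (run M O x t).pc

/-- `M` halts on input `x` with output `y`. -/
def HaltsWith (M : Machine) (O : Set Tuple) (x y : Tuple) : Prop :=
  ∃ t, M.length ≤ (run M O x t).pc ∧ (run M O x t).tuple = y

/-- `M` computes the characteristic function of `A`. -/
def Decides (M : Machine) (O A : Set Tuple) : Prop :=
  ∀ x : Tuple, x ≠ [] → (x ∈ A → HaltsWith M O x [1]) ∧ (x ∉ A → HaltsWith M O x [0])

/-- `M` computes the partial characteristic function of `A`. -/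
def SemiDecides (M : Machine) (O A : Set Tuple) : Prop :=
  ∀ x : Tuple, x ≠ [] → (x ∈ A → HaltsWith M O x [1]) ∧ (x ∉ A → ¬ Halts M O x)

/-- Equality tests on real registers. -/
def Instr.IsEqTest : Instr → Prop
  | .ifZero _ _ _ => True
  | _ => False

/-- Order tests on real registers. -/
def Instr.IsOrderTest : Instr → Prop
  | .ifNonneg _ _ _ => True
  | _ => False

/-- Oracle instructions. -/
def Instr.IsQuery : Instr → Prop
  | .query _ _ => True
  | _ => False

/-- The class of the oracle machines over `(ℝ; 0, 1; +, -; ≥)`: no equality tests on real registers.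
Together with an oracle `O` in the semantics this is the class `M_add^1(O)`. -/
def OrderOracleMachines : Set Machine := {M | ∀ c ∈ M, ¬ c.IsEqTest}

/-- The class `M_add^1`: order tests only, no oracle. -/
def OrderMachines : Set Machine := {M | ∀ c ∈ M, ¬ c.IsEqTest ∧ ¬ c.IsQuery}

/-- The class `M_add^{1,=}`: equality tests only, no oracle. -/
def EqMachines : Set Machine := {M | ∀ c ∈ M, ¬ c.IsOrderTest ∧ ¬ c.IsQuery}

/-- `A ⪯ B`: the problem `A` is decidable by a machine in `M_add^1(B)`. -/
def Easier (A B : Set Tuple) : Prop := ∃ M ∈ OrderOracleMachines, Decides M B A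

/-- `A` is strictly easier than `B`. -/
def StrictlyEasier (A B : Set Tuple) : Prop := Easier A B ∧ ¬ Easier B A

/-- The symbols of which programs consist. Numbers are written as tallies followed by a separator. -/
inductive Symb : Type
  | add | sub | setZero | setOne | ifZero | ifNonneg | copy | idxOne | idxSucc | ifIdxEq | query
  | tally | sep | endmark

/-- Every symbol is encoded by four bits. -/
def Symb.bits : Symb → List Bool
  | .add => [false, false, false, false]
  | .sub => [false, false, false, true]
  | .setZero => [false, false, true, false]
  | .setOne => [false, false, true, true]
  | .ifZero => [false, true, false, false]
  | .ifNonneg => [false, true, false, true]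
  | .copy => [false, true, true, false]
  | .idxOne => [false, true, true, true]
  | .idxSucc => [true, false, false, false]
  | .ifIdxEq => [true, false, false, true]
  | .query => [true, false, true, false]
  | .tally => [true, false, true, true]
  | .sep => [true, true, false, false]
  | .endmark => [true, true, false, true]

/-- A natural number as a string of symbols. -/
def numeral (n : ℕ) : List Symb := List.replicate n .tally ++ [.sep]

/-- An instruction as a string of symbols. -/
def Instr.symbols : Instr → List Symb
  | .add i j k => .add :: (numeral i ++ numeral j ++ numeral k)
  | .sub i j k => .sub :: (numeral i ++ numeral j ++ numeral k)
  | .setZero j => .setZero :: numeral j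
  | .setOne j => .setOne :: numeral j
  | .ifZero j l₁ l₂ => .ifZero :: (numeral j ++ numeral l₁ ++ numeral l₂)
  | .ifNonneg j l₁ l₂ => .ifNonneg :: (numeral j ++ numeral l₁ ++ numeral l₂)
  | .copy j k => .copy :: (numeral j ++ numeral k)
  | .idxOne j => .idxOne :: numeral j
  | .idxSucc j => .idxSucc :: numeral j
  | .ifIdxEq j k l₁ l₂ => .ifIdxEq :: (numeral j ++ numeral k ++ numeral l₁ ++ numeral l₂)
  | .query l₁ l₂ => .query :: (numeral l₁ ++ numeral l₂)

/-- The bits of the code of a machine: the codes of the symbols of its program, one by one. -/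
def codeBits (M : Machine) : List Bool :=
  (M.flatMap Instr.symbols ++ [Symb.endmark]).flatMap Symb.bits

/-- `code(M)`, a tuple of zeros and ones. -/
def code (M : Machine) : Tuple := (codeBits M).map fun b => if b then 1 else 0

/-- The halting problem `⋃_{n ≥ 1} {(n . x . code(M)) | x ∈ ℝ^n, M ∈ C, M(x)↓}` for a class `C` of
machines without oracle. -/
def HaltingProblem (C : Set Machine) : Set Tuple :=
  {z | ∃ (x : Tuple) (M : Machine), x ≠ [] ∧ M ∈ C ∧ Halts M ∅ x ∧
    z = (x.length : ℝ) :: (x ++ code M)}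

/-- `H_add^{1,=}`. -/
def HEq : Set Tuple := HaltingProblem EqMachines

/-- `H_add^1`. -/
def HOrder : Set Tuple := HaltingProblem OrderMachines

/-- The square root of the `j`-th prime number, where `p_1 = 2`, `p_2 = 3`, … (used for `j ≥ 1`). -/
noncomputable def sqrtPrime (j : ℕ) : ℝ := Real.sqrt (Nat.nth Nat.Prime (j - 1) : ℝ)

/-- The problem `⋃_{j ≥ 1} {j} × (ℝ \ {√p_j})`. -/
def primeRootProblem : Set Tuple :=
  {z | ∃ (j : ℕ) (x : ℝ), 1 ≤ j ∧ x ≠ sqrtPrime j ∧ z = [(j : ℝ), x]}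

/-- `P_j = {(2 . (j, x) . code(K)) | x ∈ ℝ \ {√p_j}}`. -/
def PProblem (K : Machine) (j : ℕ) : Set Tuple :=
  {z | ∃ x : ℝ, x ≠ sqrtPrime j ∧ z = 2 :: ([(j : ℝ), x] ++ code K)}

/-- `H_i = H_add^{1,=} ∪ P_1 ∪ … ∪ P_i`. -/
def HProblem (K : Machine) (i : ℕ) : Set Tuple :=
  HEq ∪ ⋃ j ∈ Set.Icc 1 i, PProblem K j

end AddBSS

/-! The negative part rests on computations with formal affine functions. If every input entry has
the form `a * x + b` with integers `a`, `b`, then so has every register content at every time,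
because only `0`, `1`, `+`, `-` and copying are available. For irrational `x` such a value vanishes
only if both coefficients do (`aff_eq_zero_iff`). An equality test therefore cannot distinguish two
irrational numbers, and membership in `HEq` of a tuple of affine functions is the same for all
irrational `x` (`mem_HEq_of_irrational`). An order test at an irrational `x₀` is decided either
identically or by a strict sign, which persists near `x₀`.

Take `x₀ = √p_(k+1)` and a machine with oracle `HProblem K k`. The `HEq` part of the oracle answers
alike for all irrational `x`. The part `P_j`, `j ≤ k`, could change near `x₀` only if some `a * x₀ +
b` were equal to `√p_j`, which `aff_sqrtPrime_ne` excludes. A halting computation makes finitely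
many queries, so the machine gives the same answer at `x₀` and at irrational points arbitrarily
close to it (`exists_iterate_affConfig_eventually`). A set that separates `x₀` from these points, as
the next level, the union and `HOrder` do, cannot be decided in this way (`not_easier_HProblem`).

The positive part consists of many-one style reductions: a primitive recursive function of the
integer entries of the input decides whether to reject or to rewrite the trailing bits and query the
oracle (`Easier.of_primrec`, `Easier.of_transform`). Primitive recursion is carried out on index
registers by structured programs that are compiled to machines. Lower levels reduce to higher ones
by rejecting the surplus inputs of `K`. The reduction to `HOrder` rewrites the code of a machine
with equality tests into that of its `orderForm`. Since `K` is not a machine with equality tests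
(`not_mem_eqMachines`), its code never occurs in `HEq`, and the cases do not interfere. A machine
`K` exists because `x ≠ √p` is witnessed by a rational number strictly between the two
(`exists_found_iff`). -/

namespace AddBSS

/-! ### Runs of machines -/

/-- The configuration `c'` is reached from `c`. -/
def Reaches (M : Machine) (O : Set Tuple) (c c' : Config) : Prop := ∃ t, (step M O)^[t] c = c'

theorem Reaches.refl {M : Machine} {O : Set Tuple} (c : Config) : Reaches M O c c := ⟨0, rfl⟩

theorem Reaches.trans {M : Machine} {O : Set Tuple} {c c' c'' : Config} (h : Reaches M O c c')
    (h' : Reaches M O c' c'') : Reaches M O c c'' := by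
  obtain ⟨t, rfl⟩ := h
  obtain ⟨t', rfl⟩ := h'
  exact ⟨t' + t, Function.iterate_add_apply _ _ _ _⟩

theorem step_of_getElem? {M : Machine} {O : Set Tuple} {c : Config} {i : Instr}
    (h : M[c.pc]? = some i) : step M O c = i.exec O c := by
  simp [step, h]

theorem step_of_le {M : Machine} {O : Set Tuple} {c : Config} (h : M.length ≤ c.pc) :
    step M O c = c := by
  simp [step, h]

theorem iterate_step_of_le {M : Machine} {O : Set Tuple} {c : Config} (h : M.length ≤ c.pc)
    (t : ℕ) : (step M O)^[t] c = c :=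
  Function.iterate_fixed (step_of_le h) t

theorem Reaches.of_step {M : Machine} {O : Set Tuple} {c c' : Config} {i : Instr}
    (h : M[c.pc]? = some i) (h' : i.exec O c = c') : Reaches M O c c' :=
  ⟨1, by simp [step_of_getElem? h, h']⟩

/-- A computation that has halted stays the same. -/
theorem iterate_step_eq_of_halted {M : Machine} {O : Set Tuple} {c : Config} {t t' : ℕ}
    (h : M.length ≤ ((step M O)^[t] c).pc) (h' : M.length ≤ ((step M O)^[t'] c).pc) :
    (step M O)^[t] c = (step M O)^[t'] c := by
  wlog htt : t ≤ t' generalizing t t'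
  · exact (this h' h (by omega)).symm
  obtain ⟨d, rfl⟩ := Nat.exists_eq_add_of_le' htt
  rw [Function.iterate_add_apply, iterate_step_of_le h]

theorem HaltsWith.unique {M : Machine} {O : Set Tuple} {x y y' : Tuple} (h : HaltsWith M O x y)
    (h' : HaltsWith M O x y') : y = y' := by
  obtain ⟨t, ht, rfl⟩ := h
  obtain ⟨t', ht', rfl⟩ := h'
  unfold run at *
  rw [iterate_step_eq_of_halted ht ht']

theorem HaltsWith.halts {M : Machine} {O : Set Tuple} {x y : Tuple} (h : HaltsWith M O x y) :
    Halts M O x := by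
  obtain ⟨t, ht, -⟩ := h
  exact ⟨t, ht⟩

/-- The computation starting in `c` does not halt. -/
def NeverHalts (M : Machine) (O : Set Tuple) (c : Config) : Prop :=
  ∀ t, ((step M O)^[t] c).pc < M.length

/-- A stopped configuration is fixed, so stopping after `n` steps from `c` would mean being stopped
after `n` steps from `c'` as well. -/
theorem NeverHalts.of_reaches {M : Machine} {O : Set Tuple} {c c' : Config}
    (h : Reaches M O c c') (h' : NeverHalts M O c') : NeverHalts M O c := by
  obtain ⟨t, rfl⟩ := h
  intro n
  by_contra! hn
  have h1 := h' n
  rw [← Function.iterate_add_apply, add_comm, Function.iterate_add_apply,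
    iterate_step_of_le hn] at h1
  exact absurd h1 (not_lt.2 hn)

/-- A computation that returns again and again to a set of unfinished configurations does not
halt. -/
theorem NeverHalts.of_invariant {M : Machine} {O : Set Tuple} (S : Set Config)
    (h : ∀ c ∈ S, c.pc < M.length ∧ ∃ c' ∈ S, Reaches M O (step M O c) c') {c : Config}
    (hc : c ∈ S) : NeverHalts M O c := by
  intro n
  induction n using Nat.strong_induction_on generalizing c with
  | _ n ih =>
    obtain ⟨hlt, c', hc', t, ht⟩ := h c hc
    rw [← Function.iterate_succ_apply] at ht
    rcases le_or_gt (t + 1) n with hn | hn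
    · obtain ⟨d, rfl⟩ := Nat.exists_eq_add_of_le' hn
      rw [Function.iterate_add_apply, ht]
      exact ih d (by omega) hc'
    -- Stopping before the return at time `t + 1` would freeze the configuration, so `c'` itself
    -- would be stopped, although it lies in `S`.
    · by_contra! hh
      obtain ⟨d, hd⟩ := Nat.exists_eq_add_of_le' hn.le
      rw [Nat.succ_eq_add_one, hd, Function.iterate_add_apply, iterate_step_of_le hh] at ht
      subst ht
      exact absurd (h _ hc').1 (by omega)

/-! ### Structured programs -/

/-- The contents of the registers. -/
structure Mem : Type where
  I : ℕ → ℕ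
  Z : ℕ → ℝ

/-- Instructions without tests. -/
inductive Op : Type
  | add (i j k : ℕ)
  | sub (i j k : ℕ)
  | setZero (j : ℕ)
  | setOne (j : ℕ)
  | copy (j k : ℕ)
  | idxOne (j : ℕ)
  | idxSucc (j : ℕ)

/-- The instruction of a machine. -/
def Op.toInstr : Op → Instr
  | .add i j k => .add i j k
  | .sub i j k => .sub i j k
  | .setZero j => .setZero j
  | .setOne j => .setOne j
  | .copy j k => .copy j k
  | .idxOne j => .idxOne j
  | .idxSucc j => .idxSucc j

/-- The effect of an instruction on the registers. -/
noncomputable def Op.exec (s : Mem) : Op → Mem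
  | .add i j k => { s with Z := Function.update s.Z i (s.Z j + s.Z k) }
  | .sub i j k => { s with Z := Function.update s.Z i (s.Z j - s.Z k) }
  | .setZero j => { s with Z := Function.update s.Z j 0 }
  | .setOne j => { s with Z := Function.update s.Z j 1 }
  | .copy j k => { s with Z := Function.update s.Z (s.I j - 1) (s.Z (s.I k - 1)) }
  | .idxOne j => { s with I := Function.update s.I j 1 }
  | .idxSucc j => { s with I := Function.update s.I j (s.I j + 1) }

/-- Tests. -/
inductive Test : Type
  | nonneg (j : ℕ)
  | idxEq (j k : ℕ)
  | idxNe (j k : ℕ)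
  | query

/-- The jump instruction for a test. -/
def Test.toInstr (l₁ l₂ : ℕ) : Test → Instr
  | .nonneg j => .ifNonneg j l₁ l₂
  | .idxEq j k => .ifIdxEq j k l₁ l₂
  | .idxNe j k => .ifIdxEq j k l₂ l₁
  | .query => .query l₁ l₂

/-- The condition of a test. -/
def Test.Holds (O : Set Tuple) (s : Mem) : Test → Prop
  | .nonneg j => 0 ≤ s.Z j
  | .idxEq j k => s.I j = s.I k
  | .idxNe j k => s.I j ≠ s.I k
  | .query => (List.range (s.I 0)).map s.Z ∈ O

/-- Structured programs. -/
inductive Prog : Type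
  | op (o : Op)
  | skip
  | seq (p q : Prog)
  | ite (t : Test) (p q : Prog)
  | loop (t : Test) (p : Prog)

namespace Prog

/-- The number of instructions of the compiled program. -/
def size : Prog → ℕ
  | op _ => 1
  | skip => 0
  | seq p q => p.size + q.size
  | ite _ p q => p.size + q.size + 2
  | loop _ p => p.size + 2

/-- The machine code of a program that starts at label `b`. -/
def compile : Prog → ℕ → List Instr
  | op o, _ => [o.toInstr]
  | skip, _ => []
  | seq p q, b => p.compile b ++ q.compile (b + p.size)
  | ite t p q, b => t.toInstr (b + 1) (b + p.size + 2) :: (p.compile (b + 1) ++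
      -- A test with equal targets serves as an unconditional jump.
      .ifIdxEq 0 0 (b + p.size + q.size + 2) (b + p.size + q.size + 2) ::
        q.compile (b + p.size + 2))
  | loop t p, b => t.toInstr (b + 1) (b + p.size + 2) :: (p.compile (b + 1) ++
      [.ifIdxEq 0 0 b b])

theorem length_compile (p : Prog) (b : ℕ) : (p.compile b).length = p.size := by
  induction p generalizing b <;> (simp [compile, size, *]; try omega)

/-- Programs without oracle queries. -/
def NoQuery : Prog → Prop
  | op _ => True
  | skip => True
  | seq p q => p.NoQuery ∧ q.NoQuery
  | ite t p q => t ≠ .query ∧ p.NoQuery ∧ q.NoQuery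
  | loop t p => t ≠ .query ∧ p.NoQuery

/-- Complete computations of a program. -/
inductive Exec (O : Set Tuple) : Prog → Mem → Mem → Prop
  | op (o : Op) (s : Mem) : Exec O (op o) s (o.exec s)
  | skip (s : Mem) : Exec O skip s s
  | seq {p q : Prog} {s s' s'' : Mem} : Exec O p s s' → Exec O q s' s'' → Exec O (seq p q) s s''
  | iteTrue {t : Test} {p q : Prog} {s s' : Mem} :
      t.Holds O s → Exec O p s s' → Exec O (ite t p q) s s'
  | iteFalse {t : Test} {p q : Prog} {s s' : Mem} :
      ¬ t.Holds O s → Exec O q s s' → Exec O (ite t p q) s s'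
  | loopTrue {t : Test} {p : Prog} {s s' s'' : Mem} :
      t.Holds O s → Exec O p s s' → Exec O (loop t p) s' s'' → Exec O (loop t p) s s''
  | loopFalse {t : Test} {p : Prog} {s : Mem} : ¬ t.Holds O s → Exec O (loop t p) s s

/-- Some computations that do not end. -/
inductive Diverges (O : Set Tuple) : Prog → Mem → Prop
  | seqLeft {p q : Prog} {s : Mem} : Diverges O p s → Diverges O (seq p q) s
  | seqRight {p q : Prog} {s s' : Mem} : Exec O p s s' → Diverges O q s' → Diverges O (seq p q) s
  | loop {t : Test} {p : Prog} (S : Set Mem) :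
      (∀ s ∈ S, t.Holds O s ∧ ∃ s' ∈ S, Exec O p s s') → ∀ s ∈ S, Diverges O (loop t p) s

end Prog

/-- The code `l` is a part of the machine, starting at label `b`. -/
def CodeAt (M : Machine) (b : ℕ) (l : List Instr) : Prop :=
  ∀ i, i < l.length → M[b + i]? = l[i]?

theorem codeAt_cons {M : Machine} {b : ℕ} {c : Instr} {l : List Instr} :
    CodeAt M b (c :: l) ↔ M[b]? = some c ∧ CodeAt M (b + 1) l := by
  refine ⟨fun h => ⟨by simpa using h 0, fun i hi => ?_⟩, fun h i hi => ?_⟩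
  · simpa [add_assoc, add_comm 1] using h (i + 1) (by simpa using hi)
  · cases i with
    | zero => simpa using h.1
    | succ i => simpa [add_assoc, add_comm 1] using h.2 i (by simpa using hi)

theorem codeAt_append {M : Machine} {b : ℕ} {l l' : List Instr} :
    CodeAt M b (l ++ l') ↔ CodeAt M b l ∧ CodeAt M (b + l.length) l' := by
  induction l generalizing b with
  | nil => simp [CodeAt]
  | cons c l ih => simp [codeAt_cons, ih, and_assoc, add_assoc, add_comm 1]

theorem Op.exec_toInstr (O : Set Tuple) (o : Op) (b : ℕ) (s : Mem) :
    o.toInstr.exec O ⟨b, s.I, s.Z⟩ = ⟨b + 1, (o.exec s).I, (o.exec s).Z⟩ := by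
  cases o <;> rfl

open Classical in
theorem Test.exec_toInstr (O : Set Tuple) (t : Test) (b l₁ l₂ : ℕ) (s : Mem) :
    (t.toInstr l₁ l₂).exec O ⟨b, s.I, s.Z⟩ = ⟨if t.Holds O s then l₁ else l₂, s.I, s.Z⟩ := by
  by_cases h : t.Holds O s
  · rw [if_pos h]
    cases t <;> simp_all [Test.toInstr, Instr.exec, Test.Holds, Config.tuple]
  · rw [if_neg h]
    cases t <;> simp_all [Test.toInstr, Instr.exec, Test.Holds, Config.tuple]

/-- Correctness of the compiler, by induction on the computation rather than on the program: in a
further round of a loop the same code is used again. -/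
theorem Prog.Exec.reaches {O : Set Tuple} {p : Prog} {s s' : Mem} (h : p.Exec O s s')
    {M : Machine} {b : ℕ} (hM : CodeAt M b (p.compile b)) :
    Reaches M O ⟨b, s.I, s.Z⟩ ⟨b + p.size, s'.I, s'.Z⟩ := by
  induction h generalizing b with
  | op o s =>
    simp only [compile, codeAt_cons] at hM
    exact .of_step hM.1 (o.exec_toInstr O b s)
  | skip s => exact .refl _
  | seq h₁ h₂ ih₁ ih₂ =>
    simp only [compile, codeAt_append, length_compile] at hM
    simpa [size, add_assoc] using (ih₁ hM.1).trans (ih₂ hM.2)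
  | @iteTrue t p q s s' ht h ih =>
    simp only [compile, codeAt_append, codeAt_cons, length_compile] at hM
    obtain ⟨h1, h2, h3, h4⟩ := hM
    refine (Reaches.of_step (c' := ⟨b + 1, s.I, s.Z⟩) h1 ?_).trans ((ih h2).trans
      (.of_step h3 ?_))
    · rw [Test.exec_toInstr, if_pos ht]
    · simp [Instr.exec, size]; omega
  | @iteFalse t p q s s' ht h ih =>
    simp only [compile, codeAt_append, codeAt_cons, length_compile] at hM
    obtain ⟨h1, h2, h3, h4⟩ := hM
    have e : b + 1 + p.size + 1 = b + p.size + 2 := by omega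
    rw [e] at h4
    refine (Reaches.of_step (c' := ⟨b + p.size + 2, s.I, s.Z⟩) h1 ?_).trans ?_
    · rw [Test.exec_toInstr, if_neg ht]
    · convert ih h4 using 2
      simp [size]; omega
  | @loopTrue t p s s' s'' ht h₁ h₂ ih₁ ih₂ =>
    have hM' := hM
    simp only [compile, codeAt_append, codeAt_cons, length_compile] at hM
    obtain ⟨h1, h2, h3, h4⟩ := hM
    refine (Reaches.of_step (c' := ⟨b + 1, s.I, s.Z⟩) h1 ?_).trans ((ih₁ h2).trans
      ((Reaches.of_step (c' := ⟨b, s'.I, s'.Z⟩) h3 ?_).trans (ih₂ hM')))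
    · rw [Test.exec_toInstr, if_pos ht]
    · simp [Instr.exec]
  | @loopFalse t p s ht =>
    simp only [compile, codeAt_append, codeAt_cons, length_compile] at hM
    refine .of_step hM.1 ?_
    rw [Test.exec_toInstr, if_neg ht]
    simp [size]; omega

/-- For a loop, the configurations at its first label with registers in `S` form the recurring set
required by `NeverHalts.of_invariant`. -/
theorem Prog.Diverges.neverHalts {O : Set Tuple} {p : Prog} {s : Mem} (h : p.Diverges O s)
    {M : Machine} {b : ℕ} (hM : CodeAt M b (p.compile b)) : NeverHalts M O ⟨b, s.I, s.Z⟩ := by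
  induction h generalizing b with
  | seqLeft h ih =>
    simp only [compile, codeAt_append] at hM
    exact ih hM.1
  | seqRight h₁ h₂ ih =>
    simp only [compile, codeAt_append, length_compile] at hM
    exact .of_reaches (h₁.reaches hM.1) (ih hM.2)
  | @loop t p S hS s hs =>
    simp only [compile, codeAt_append, codeAt_cons, length_compile] at hM
    obtain ⟨h1, h2, h3, h4⟩ := hM
    refine NeverHalts.of_invariant {c | ∃ s ∈ S, c = ⟨b, s.I, s.Z⟩} ?_ ⟨s, hs, rfl⟩
    rintro _ ⟨s, hs, rfl⟩
    obtain ⟨ht, s', hs', he⟩ := hS s hs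
    refine ⟨(List.getElem?_eq_some_iff.1 h1).1, _, ⟨s', hs', rfl⟩, ?_⟩
    rw [step_of_getElem? h1, Test.exec_toInstr, if_pos ht]
    exact (he.reaches h2).trans (.of_step h3 (by simp [Instr.exec]))

/-! ### Total correctness -/

namespace Prog

/-- The program stops, and then the contents of the registers have the property `Q`. -/
def Ensures (O : Set Tuple) (p : Prog) (Q : Mem → Prop) (s : Mem) : Prop :=
  ∃ s', p.Exec O s s' ∧ Q s'

variable {O : Set Tuple} {p q : Prog} {t : Test} {Q R : Mem → Prop} {s : Mem}

theorem Ensures.mono (h : p.Ensures O Q s) (hQ : ∀ s, Q s → R s) : p.Ensures O R s := by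
  obtain ⟨s', h, h'⟩ := h
  exact ⟨s', h, hQ _ h'⟩

theorem ensures_op {o : Op} (h : Q (o.exec s)) : (op o).Ensures O Q s := ⟨_, .op o s, h⟩

theorem ensures_skip (h : Q s) : skip.Ensures O Q s := ⟨_, .skip s, h⟩

theorem ensures_seq (h : p.Ensures O (q.Ensures O Q) s) : (seq p q).Ensures O Q s := by
  obtain ⟨s', h, s'', h', hQ⟩ := h
  exact ⟨s'', .seq h h', hQ⟩

theorem ensures_ite (h : t.Holds O s → p.Ensures O Q s) (h' : ¬ t.Holds O s → q.Ensures O Q s) :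
    (ite t p q).Ensures O Q s := by
  by_cases ht : t.Holds O s
  · obtain ⟨s', h, hQ⟩ := h ht
    exact ⟨s', .iteTrue ht h, hQ⟩
  · obtain ⟨s', h, hQ⟩ := h' ht
    exact ⟨s', .iteFalse ht h, hQ⟩

/-- The rule for a loop with a bound `n` for the number of rounds. -/
theorem ensures_loop (Inv : ℕ → Mem → Prop) (h0 : ∀ s, Inv 0 s → ¬ t.Holds O s)
    (hs : ∀ n s, Inv (n + 1) s → t.Holds O s ∧ p.Ensures O (Inv n) s)
    {n : ℕ} (h : Inv n s) : (loop t p).Ensures O (Inv 0) s := by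
  induction n generalizing s with
  | zero => exact ⟨s, .loopFalse (h0 s h), h⟩
  | succ n ih =>
    obtain ⟨ht, s', h1, h2⟩ := hs n s h
    obtain ⟨s'', h3, h4⟩ := ih h2
    exact ⟨s'', .loopTrue ht h1 h3, h4⟩

end Prog

/-! ### Programs as machines -/

theorem Prog.codeAt_compile (p : Prog) : CodeAt (p.compile 0) 0 (p.compile 0) := by
  intro i _
  simp

theorem Prog.Ensures.haltsWith {O : Set Tuple} {p : Prog} {x y : Tuple}
    (h : p.Ensures O (fun s => (List.range (s.I 0)).map s.Z = y)
      ⟨fun _ => x.length, fun i => x.getD i 0⟩) : HaltsWith (p.compile 0) O x y := by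
  obtain ⟨s', h, hy⟩ := h
  obtain ⟨t, ht⟩ := h.reaches p.codeAt_compile
  refine ⟨t, ?_⟩
  change (step (p.compile 0) O)^[t] (start x) = _ at ht
  rw [run, ht]
  simp [length_compile, Config.tuple, hy]

theorem Prog.Diverges.not_halts {O : Set Tuple} {p : Prog} {x : Tuple}
    (h : p.Diverges O ⟨fun _ => x.length, fun i => x.getD i 0⟩) : ¬ Halts (p.compile 0) O x := by
  rintro ⟨t, ht⟩
  exact absurd (h.neverHalts p.codeAt_compile t) (not_lt.2 ht)

theorem Prog.compile_not_isEqTest (p : Prog) (b : ℕ) : ∀ c ∈ p.compile b, ¬ c.IsEqTest := by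
  induction p generalizing b with
  | op o => cases o <;> simp [compile, Op.toInstr, Instr.IsEqTest]
  | skip => simp [compile]
  | seq p q hp hq =>
    simp only [compile, List.mem_append]
    rintro c (h | h)
    exacts [hp _ c h, hq _ c h]
  | ite t p q hp hq =>
    simp only [compile, List.mem_append, List.mem_cons]
    rintro c (rfl | h | rfl | h)
    exacts [by cases t <;> simp [Test.toInstr, Instr.IsEqTest], hp _ c h, by simp [Instr.IsEqTest],
      hq _ c h]
  | loop t p hp =>
    simp only [compile, List.mem_append, List.mem_cons]
    rintro c (rfl | h | rfl | h)
    exacts [by cases t <;> simp [Test.toInstr, Instr.IsEqTest], hp _ c h, by simp [Instr.IsEqTest],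
      by simp at h]

theorem Prog.NoQuery.compile_not_isQuery {p : Prog} (hp : p.NoQuery) (b : ℕ) :
    ∀ c ∈ p.compile b, ¬ c.IsQuery := by
  induction p generalizing b with
  | op o => cases o <;> simp [compile, Op.toInstr, Instr.IsQuery]
  | skip => simp [compile]
  | seq p q ihp ihq =>
    simp only [compile, List.mem_append]
    rintro c (h | h)
    exacts [ihp hp.1 _ c h, ihq hp.2 _ c h]
  | ite t p q ihp ihq =>
    obtain ⟨ht, hp, hq⟩ := hp
    simp only [compile, List.mem_append, List.mem_cons]
    rintro c (rfl | h | rfl | h)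
    exacts [by cases t <;> simp_all [Test.toInstr, Instr.IsQuery], ihp hp _ c h,
      by simp [Instr.IsQuery], ihq hq _ c h]
  | loop t p ihp =>
    obtain ⟨ht, hp⟩ := hp
    simp only [compile, List.mem_append, List.mem_cons]
    rintro c (rfl | h | rfl | h)
    exacts [by cases t <;> simp_all [Test.toInstr, Instr.IsQuery], ihp hp _ c h,
      by simp [Instr.IsQuery], by simp at h]

theorem Prog.compile_mem_orderOracleMachines (p : Prog) : p.compile 0 ∈ OrderOracleMachines :=
  p.compile_not_isEqTest 0

theorem Prog.NoQuery.compile_mem_orderMachines {p : Prog} (hp : p.NoQuery) :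
    p.compile 0 ∈ OrderMachines :=
  fun c hc => ⟨p.compile_not_isEqTest 0 c hc, hp.compile_not_isQuery 0 c hc⟩

end AddBSS

namespace AddBSS



namespace Prog

/-! ### Primitive recursive functions on index registers

The number `v` is represented by the content `v + 1` of an index register. -/

/-- Increase `I_a` until it equals `I_r`. -/
def upTo (r a : ℕ) : Prog := loop (.idxNe r a) (op (.idxSucc a))

theorem ensures_upTo {O : Set Tuple} {r a : ℕ} (h : a ≠ r) {s : Mem} (hs : s.I a ≤ s.I r) :
    (upTo r a).Ensures O (fun s' => s'.Z = s.Z ∧ s'.I a = s.I r ∧ ∀ k, k ≠ a → s'.I k = s.I k) s := by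
  refine (ensures_loop (fun n s' => s'.Z = s.Z ∧ s'.I a + n = s.I r ∧
    ∀ k, k ≠ a → s'.I k = s.I k) ?_ ?_ (n := s.I r - s.I a) ?_).mono fun s' h' => ?_
  · rintro s' ⟨-, h1, h2⟩
    simp [Test.Holds, h2 r h.symm, ← h1]
  · rintro n s' ⟨h1, h2, h3⟩
    refine ⟨?_, ensures_op ⟨h1, ?_, fun k hk => ?_⟩⟩
    · simp only [Test.Holds, h3 r h.symm]; omega
    · simp [Op.exec]; omega
    · simp [Op.exec, hk, h3 k hk]
  · exact ⟨rfl, by omega, fun _ _ => rfl⟩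
  · simpa using h'

/-- `I_out := I_r`, where `I_t` is a scratch register. -/
def move (r out t : ℕ) : Prog :=
  seq (op (.idxOne t)) (seq (upTo r t) (seq (op (.idxOne out)) (upTo t out)))

/-- Index registers can only be reset and incremented, so copying means counting up. The detour
through `I_t` saves the value before `out` is reset, which makes `out = r` admissible. -/
theorem ensures_move {O : Set Tuple} {r out t : ℕ} (hr : t ≠ r) (ho : t ≠ out) {s : Mem}
    (hs : 1 ≤ s.I r) : (move r out t).Ensures O (fun s' => s'.Z = s.Z ∧ s'.I out = s.I r ∧
      ∀ k, k ≠ t → k ≠ out → s'.I k = s.I k) s := by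
  refine ensures_seq (ensures_op (ensures_seq ((ensures_upTo hr ?_).mono ?_)))
  · simpa [Op.exec, hr.symm] using hs
  rintro s₁ ⟨hZ, h1, h2⟩
  have e : (Op.exec s (.idxOne t)).I r = s.I r := by simp [Op.exec, hr.symm]
  rw [e] at h1
  refine ensures_seq (ensures_op ((ensures_upTo ho.symm ?_).mono ?_))
  · simpa [Op.exec, ho, h1] using hs
  rintro s₂ ⟨hZ', h1', h2'⟩
  refine ⟨hZ'.trans hZ, ?_, fun k hk hk' => ?_⟩
  · simp [h1', Op.exec, ho, h1]
  · rw [h2' k hk']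
    simp [Op.exec, hk', h2 k hk, hk]

theorem noQuery_move (r out t : ℕ) : (move r out t).NoQuery := by simp [move, upTo, NoQuery]

/-- The program computes `f` with the arguments in the registers `args` and the value in the
register `out`; it does not change other index registers below `lo`. -/
def Computes {n : ℕ} (p : Prog) (f : List.Vector ℕ n → ℕ) (args : Fin n → ℕ) (out lo : ℕ) : Prop :=
  p.NoQuery ∧ ∀ (O : Set Tuple) (s : Mem) (v : List.Vector ℕ n),
    (∀ i, s.I (args i) = v.get i + 1) → p.Ensures O (fun s' => s'.Z = s.Z ∧
      s'.I out = f v + 1 ∧ ∀ k, k < lo → k ≠ out → s'.I k = s.I k) s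

/-- The values are collected in the registers from `lo` on. Each `g i` is compiled with `lo + n` as
its lower bound for scratch registers, so it spares both the arguments and the values already found.
-/
theorem exists_computes_all {n m : ℕ} {g : Fin n → List.Vector ℕ m → ℕ}
    (hg : ∀ i (lo : ℕ) (args : Fin m → ℕ) (out : ℕ), (∀ i, args i < lo) → out < lo →
      ∃ p, Computes p (g i) args out lo) (lo : ℕ) (args : Fin m → ℕ) (hargs : ∀ i, args i < lo)
    (k : ℕ) (hk : k ≤ n) : ∃ p : Prog, p.NoQuery ∧ ∀ (O : Set Tuple) (s : Mem) (v : List.Vector ℕ m),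
      (∀ i, s.I (args i) = v.get i + 1) → p.Ensures O (fun s' => s'.Z = s.Z ∧
        (∀ i : Fin n, i < k → s'.I (lo + i) = g i v + 1) ∧ ∀ r, r < lo → s'.I r = s.I r) s := by
  induction k with
  | zero => exact ⟨skip, trivial, fun O s v _ => ensures_skip ⟨rfl, by simp, fun _ _ => rfl⟩⟩
  | succ k ih =>
    obtain ⟨p, hp, hps⟩ := ih (by omega)
    obtain ⟨q, hq, hqs⟩ := hg ⟨k, hk⟩ (lo + n) args (lo + k) (fun i => (hargs i).trans_le (by omega))
      (by omega)
    refine ⟨seq p q, ⟨hp, hq⟩, fun O s v hv => ensures_seq ((hps O s v hv).mono ?_)⟩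
    rintro s₁ ⟨hZ, h1, h2⟩
    refine (hqs O s₁ v fun i => by rw [h2 _ (hargs i), hv]).mono ?_
    rintro s₂ ⟨hZ', h1', h2'⟩
    refine ⟨hZ'.trans hZ, fun i hi => ?_, fun r hr => ?_⟩
    · rcases Nat.lt_succ_iff_lt_or_eq.1 hi with hi | hi
      · rw [h2' _ (by omega) (by omega), h1 i hi]
      · have : i = ⟨k, hk⟩ := Fin.ext hi
        subst this
        exact h1'
    · rw [h2' _ (by omega) (by omega), h2 r hr]

/-- The bound `lo` is what makes the induction work: every subprogram gets its scratch space above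
everything that is still needed. -/
theorem exists_computes {n : ℕ} {f : List.Vector ℕ n → ℕ} (hf : Nat.Primrec' f) :
    ∀ (lo : ℕ) (args : Fin n → ℕ) (out : ℕ), (∀ i, args i < lo) → out < lo →
      ∃ p, Computes p f args out lo := by
  induction hf with
  | zero =>
    intro lo args out _ _
    refine ⟨op (.idxOne out), trivial, fun O s v _ => ensures_op ⟨rfl, by simp [Op.exec], ?_⟩⟩
    intro k _ hk
    simp [Op.exec, hk]
  | succ =>
    intro lo args out ha ho
    refine ⟨seq (move (args 0) out lo) (op (.idxSucc out)), ⟨noQuery_move _ _ _, trivial⟩,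
      fun O s v hv => ensures_seq ((ensures_move (ha 0).ne' ho.ne' (by simp [hv])).mono ?_)⟩
    rintro s₁ ⟨hZ, h1, h2⟩
    refine ensures_op ⟨hZ, ?_, fun k hk hk' => ?_⟩
    · simp [Op.exec, h1, hv]
    · simp [Op.exec, hk', h2 k hk.ne hk']
  | get i =>
    intro lo args out ha ho
    refine ⟨move (args i) out lo, noQuery_move _ _ _,
      fun O s v hv => (ensures_move (ha i).ne' ho.ne' (by simp [hv])).mono ?_⟩
    rintro s₁ ⟨hZ, h1, h2⟩
    exact ⟨hZ, by rw [h1, hv], fun k hk hk' => h2 k hk.ne hk'⟩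
  | @comp n m f g _ _ ihf ihg =>
    intro lo args out ha ho
    obtain ⟨p, hp, hps⟩ := exists_computes_all ihg lo args ha _ le_rfl
    obtain ⟨q, hq, hqs⟩ := ihf (lo + m) (fun i => lo + i) out (fun i => by omega) (by omega)
    refine ⟨seq p q, ⟨hp, hq⟩, fun O s v hv => ensures_seq ((hps O s v hv).mono ?_)⟩
    rintro s₁ ⟨hZ, h1, h2⟩
    refine (hqs O s₁ (List.Vector.ofFn fun i => g i v) fun i => by simp [h1 i i.2]).mono ?_
    rintro s₂ ⟨hZ', h1', h2'⟩
    exact ⟨hZ'.trans hZ, h1', fun k hk hk' => by rw [h2' k (by omega) hk', h2 k hk]⟩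
  | @prec n f g _ _ ihf ihg =>
    intro lo args out ha ho
    obtain ⟨p, hp, hps⟩ := ihf (lo + 2) (fun i => args i.succ) (lo + 1)
      (fun i => (ha _).trans_le (by omega)) (by omega)
    obtain ⟨q, hq, hqs⟩ := ihg (lo + 2)
      (Fin.cons lo (Fin.cons (lo + 1) fun i => args i.succ)) (lo + 1)
      (by
        refine Fin.cases (by simp) (Fin.cases (by simp) fun i => ?_)
        simpa using (ha _).trans_le (by omega)) (by omega)
    -- `lo` is the recursion counter and `lo + 1` the accumulator; the scratch space of `p` and `q`
    -- begins at `lo + 2`.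
    refine ⟨seq p (seq (op (.idxOne lo)) (seq (loop (.idxNe lo (args 0))
      (seq q (op (.idxSucc lo)))) (move (lo + 1) out (lo + 2)))),
      ⟨hp, trivial, ⟨by simp, hq, trivial⟩, noQuery_move _ _ _⟩, fun O s v hv =>
      ensures_seq ((hps O s v.tail fun i => by simpa using hv i.succ).mono ?_)⟩
    rintro s₁ ⟨hZ, h1, h2⟩
    refine ensures_seq (ensures_op (ensures_seq ((ensures_loop (fun k s' => s'.Z = s.Z ∧
      (∀ r, r < lo → s'.I r = s.I r) ∧ ∃ y, y + k = v.head ∧ s'.I lo = y + 1 ∧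
        s'.I (lo + 1) = (Nat.rec (f v.tail) (fun y IH => g (y ::ᵥ IH ::ᵥ v.tail)) y : ℕ) + 1)
      ?_ ?_ (n := v.head) ?_).mono ?_)))
    · rintro s' ⟨-, h3, y, hy, h4, -⟩
      have := hv 0
      simp only [List.Vector.get_zero] at this
      simp [Test.Holds, h4, h3 _ (ha 0), this, ← hy]
    · rintro k s' ⟨hZ', h3, y, hy, h4, h5⟩
      have := hv 0
      simp only [List.Vector.get_zero] at this
      refine ⟨?_, ensures_seq ((hqs O s' (y ::ᵥ (Nat.rec (f v.tail)
        (fun y IH => g (y ::ᵥ IH ::ᵥ v.tail)) y) ::ᵥ v.tail) (Fin.cases (by simpa using h4)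
        (Fin.cases h5 fun i => by simp [h3 _ (ha _), hv]))).mono ?_)⟩
      · simp only [Test.Holds, h4, h3 _ (ha 0), this]; omega
      · rintro s'' ⟨hZ'', h6, h7⟩
        refine ensures_op ⟨hZ''.trans hZ', fun r hr => ?_, y + 1, by omega, ?_, ?_⟩
        · simp [Op.exec, hr.ne, h7 r (by omega) (by omega), h3 r hr]
        · simp [Op.exec, h7 lo (by omega) (by omega), h4]
        · simpa [Op.exec] using h6
    · refine ⟨hZ, fun r hr => ?_, 0, by simp, by simp [Op.exec], by simpa [Op.exec] using h1⟩
      simp [Op.exec, hr.ne, h2 r (by omega) (by omega)]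
    · rintro s' ⟨hZ', h3, y, hy, h4, h5⟩
      refine (ensures_move (by omega) (by omega) (by omega)).mono ?_
      rintro s'' ⟨hZ'', h6, h7⟩
      refine ⟨hZ''.trans hZ', ?_, fun k hk hk' => ?_⟩
      · obtain rfl : y = v.head := hy
        exact h6.trans h5
      · rw [h7 k (by omega) hk', h3 k hk]

/-- A program for a primitive recursive function of one variable. -/
theorem exists_computes₁ {f : ℕ → ℕ} (hf : Primrec f) (lo r out : ℕ) (hr : r < lo)
    (ho : out < lo) : ∃ p : Prog, p.NoQuery ∧ ∀ (O : Set Tuple) (s : Mem) (v : ℕ),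
      s.I r = v + 1 → p.Ensures O (fun s' => s'.Z = s.Z ∧
        s'.I out = f v + 1 ∧ ∀ k, k < lo → k ≠ out → s'.I k = s.I k) s := by
  obtain ⟨p, hp, h⟩ := exists_computes (Nat.Primrec'.prim_iff₁.2 hf) lo (fun _ => r) out
    (fun _ => hr) ho
  refine ⟨p, hp, fun O s v hv => ?_⟩
  simpa using h O s (v ::ᵥ .nil) fun i => by
    rw [hv, Subsingleton.elim i 0]; simp

/-- A program for a primitive recursive function of two variables. -/
theorem exists_computes₂ {f : ℕ → ℕ → ℕ} (hf : Primrec₂ f) (lo r₁ r₂ out : ℕ) (hr₁ : r₁ < lo)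
    (hr₂ : r₂ < lo) (ho : out < lo) : ∃ p : Prog, p.NoQuery ∧
      ∀ (O : Set Tuple) (s : Mem) (v w : ℕ), s.I r₁ = v + 1 → s.I r₂ = w + 1 →
        p.Ensures O (fun s' => s'.Z = s.Z ∧
          s'.I out = f v w + 1 ∧ ∀ k, k < lo → k ≠ out → s'.I k = s.I k) s := by
  obtain ⟨p, hp, h⟩ := exists_computes (Nat.Primrec'.prim_iff₂.2 hf) lo
    (Fin.cons r₁ fun _ => r₂) out (Fin.cases hr₁ fun _ => hr₂) ho
  refine ⟨p, hp, fun O s v w hv hw => ?_⟩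
  simpa using h O s (v ::ᵥ w ::ᵥ .nil) (Fin.cases (by simpa using hv) fun i => by
    rw [Subsingleton.elim i 0]; exact hw)

end Prog

end AddBSS

namespace AddBSS

namespace Prog

section

variable {O : Set Tuple} {p q : Prog} {Q : Mem → Prop}

/-- As equations, this rule and the next let `simp` compute weakest preconditions of straight-line
code. -/
theorem ensures_op_eq {o : Op} : (op o).Ensures O Q = fun s => Q (o.exec s) :=
  funext fun _ => propext ⟨fun ⟨_, h, hQ⟩ => by cases h; exact hQ, ensures_op⟩

theorem ensures_seq_eq : (seq p q).Ensures O Q = p.Ensures O (q.Ensures O Q) :=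
  funext fun _ => propext
    ⟨fun ⟨_, h, hQ⟩ => by cases h with | seq h₁ h₂ => exact ⟨_, h₁, _, h₂, hQ⟩, ensures_seq⟩

end

/-! ### Primitive recursive functions on encoded data -/

section

open Encodable

variable {α β γ : Type*} [Primcodable α] [Primcodable β] [Primcodable γ]

/-- The function is conjugated with `encode` and `decode`; the default `0` for undecodable numbers
is never met under the hypothesis on `I_r`. -/
theorem exists_program₁ {f : α → β} (hf : Primrec f) (lo r out : ℕ) (hr : r < lo)
    (ho : out < lo) : ∃ p : Prog, p.NoQuery ∧ ∀ (O : Set Tuple) (s : Mem) (a : α),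
      s.I r = encode a + 1 → p.Ensures O (fun s' => s'.Z = s.Z ∧
        s'.I out = encode (f a) + 1 ∧ ∀ k, k < lo → k ≠ out → s'.I k = s.I k) s := by
  obtain ⟨p, hp, h⟩ := exists_computes₁
    (f := fun n => ((decode n : Option α).map fun a => encode (f a)).getD 0)
    (Primrec.option_getD.comp (Primrec.option_map Primrec.decode
      (Primrec.encode.comp (hf.comp .snd)).to₂) (.const 0)) lo r out hr ho
  refine ⟨p, hp, fun O s a hs => ?_⟩
  simpa using h O s _ hs

theorem exists_program₂ {f : α → β → γ} (hf : Primrec₂ f) (lo r₁ r₂ out : ℕ) (hr₁ : r₁ < lo)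
    (hr₂ : r₂ < lo) (ho : out < lo) : ∃ p : Prog, p.NoQuery ∧
      ∀ (O : Set Tuple) (s : Mem) (a : α) (b : β), s.I r₁ = encode a + 1 → s.I r₂ = encode b + 1 →
        p.Ensures O (fun s' => s'.Z = s.Z ∧
          s'.I out = encode (f a b) + 1 ∧ ∀ k, k < lo → k ≠ out → s'.I k = s.I k) s := by
  obtain ⟨p, hp, h⟩ := exists_computes₂
    (f := fun m n => ((decode (Nat.pair m n) : Option (α × β)).map
      fun a => encode (f a.1 a.2)).getD 0)
    (Primrec.option_getD.comp (Primrec.option_map (Primrec.decode.comp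
      (Primrec₂.natPair.comp .fst .snd))
      (Primrec.encode.comp (hf.comp (Primrec.fst.comp .snd) (Primrec.snd.comp .snd))).to₂)
        (.const 0)) lo r₁ r₂ out hr₁ hr₂ ho
  refine ⟨p, hp, fun O s a b hs hs' => ?_⟩
  have := h O s _ _ hs hs'
  -- Pairs are encoded by `Nat.pair`, so the two registers together determine a decodable pair.
  rw [show Nat.pair (encode a) (encode b) = encode (a, b) from rfl, Encodable.encodek] at this
  simpa using this

end

/-! ### Copying blocks of real registers -/

/-- Copy registers beginning at `I_src` to the registers beginning at `I_tgt`, until `I_src` equals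
`I_fin`. -/
def copyBlock (src tgt fin : ℕ) : Prog :=
  loop (.idxNe src fin) (seq (op (.copy tgt src)) (seq (op (.idxSucc src)) (op (.idxSucc tgt))))

theorem noQuery_copyBlock (src tgt fin : ℕ) : (copyBlock src tgt fin).NoQuery := by
  simp [copyBlock, NoQuery]

/-- The condition `hd` says that no register is overwritten before it is read. It allows overlapping
blocks when the target lies below the source. -/
theorem ensures_copyBlock {O : Set Tuple} {src tgt fin : ℕ} (h₁ : src ≠ tgt) (h₂ : src ≠ fin)
    (h₃ : tgt ≠ fin) {s : Mem} {a b n : ℕ} (hs : s.I src = a + 1) (ht : s.I tgt = b + 1)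
    (hn : s.I fin = a + n + 1) (hd : ∀ i j, j < i → i < n → b + j ≠ a + i) :
    (copyBlock src tgt fin).Ensures O (fun s' => s'.I tgt = b + n + 1 ∧
      (∀ k, k ≠ src → k ≠ tgt → s'.I k = s.I k) ∧
      ∀ k, s'.Z k = if b ≤ k ∧ k < b + n then s.Z (a + (k - b)) else s.Z k) s := by
  refine (ensures_loop (fun m s' => ∃ i, i + m = n ∧ s'.I src = a + i + 1 ∧ s'.I tgt = b + i + 1 ∧
    (∀ k, k ≠ src → k ≠ tgt → s'.I k = s.I k) ∧
      ∀ k, s'.Z k = if b ≤ k ∧ k < b + i then s.Z (a + (k - b)) else s.Z k)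
    ?_ ?_ (n := n) ?_).mono ?_
  · rintro s' ⟨i, rfl, h4, h5, h6, -⟩
    simp [Test.Holds, h4, h6 fin h₂.symm h₃.symm, hn]
  · rintro m s' ⟨i, hi, h4, h5, h6, h7⟩
    simp only [Test.Holds, ensures_seq_eq, ensures_op_eq, Op.exec]
    refine ⟨?_, i + 1, by omega, ?_, ?_, fun k hk hk' => ?_, fun k => ?_⟩
    · rw [h4, h6 fin h₂.symm h₃.symm, hn]; omega
    · simp [h₁, h4]; omega
    · simp [h₁.symm, h5]; omega
    · simp [hk, hk', h6 k hk hk']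
    · simp only [h4, h5, add_tsub_cancel_right]
      by_cases hk : k = b + i
      · subst hk
        rw [Function.update_self, h7, if_neg, if_pos (by omega)]
        · simp
        · rintro ⟨h8, h9⟩
          refine hd i (a + i - b) ?_ ?_ ?_ <;> omega
      · rw [Function.update_of_ne hk, h7]
        congr 1
        simp only [eq_iff_iff]
        omega
  · exact ⟨0, by simp, by simpa, by simpa, fun _ _ _ => rfl, fun k => by
      rw [if_neg]; omega⟩
  · rintro s' ⟨i, rfl, h4, h5, h6, h7⟩
    exact ⟨h5, h6, h7⟩

/-! ### Reading natural numbers -/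

end Prog

/-- The number `n + 1` for a natural number `n`, the number `0` for all other reals. -/
noncomputable def natCode (y : ℝ) : ℕ := open Classical in if y = ⌊y⌋₊ then ⌊y⌋₊ + 1 else 0

theorem natCode_natCast (n : ℕ) : natCode n = n + 1 := by simp [natCode]

theorem natCode_eq_succ {y : ℝ} {n : ℕ} : natCode y = n + 1 ↔ y = n := by
  refine ⟨fun h => ?_, fun h => h ▸ natCode_natCast n⟩
  unfold natCode at h
  split_ifs at h with h'
  · rw [h', Nat.succ_injective h]

namespace Prog

/-- The index register `out` gets the number `natCode` of the content of the real register with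
the address in the index register `r`. The scratch registers are `Z_1`, `Z_2`, `Z_3`. -/
def readNat (r out one : ℕ) : Prog :=
  seq (op (.idxOne one)) <| seq (op (.copy one r)) <| seq (op (.setOne 1)) <|
  seq (op (.sub 0 0 1)) <| seq (op (.idxOne out)) <|
  seq (loop (.nonneg 0) (seq (op (.sub 0 0 1)) (op (.idxSucc out)))) <|
  seq (op (.add 0 0 1)) <| seq (op (.setZero 2)) <| seq (op (.sub 2 2 0)) <|
  ite (.nonneg 2) (ite (.nonneg 0) (op (.idxSucc out)) (op (.idxOne out))) (op (.idxOne out))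

theorem noQuery_readNat (r out one : ℕ) : (readNat r out one).NoQuery := by
  simp [readNat, NoQuery]

/-- Subtracting `1` until the value is negative, and adding it back once, leaves the fractional part
of a nonnegative `y`. Whether the rest is zero is found by testing the signs of it and of its
negative, since only order tests are available. -/
theorem ensures_readNat {O : Set Tuple} {r out one : ℕ} (h₁ : r ≠ one) (h₂ : out ≠ one) {s : Mem} :
    (readNat r out one).Ensures O (fun s' => s'.I out = natCode (s.Z (s.I r - 1)) + 1 ∧
      s'.I one = 1 ∧ (∀ k, k ≠ out → k ≠ one → s'.I k = s.I k) ∧ ∀ k, 3 ≤ k → s'.Z k = s.Z k) s := by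
  generalize hy : s.Z (s.I r - 1) = y
  simp only [readNat, ensures_seq_eq, ensures_op_eq]
  refine (ensures_loop (fun n s' => s'.I one = 1 ∧ (∀ k, k ≠ out → k ≠ one → s'.I k = s.I k) ∧
    (∀ k, 3 ≤ k → s'.Z k = s.Z k) ∧ s'.Z 1 = 1 ∧ ∃ i : ℕ, s'.I out = i + 1 ∧ s'.Z 0 = y - i - 1 ∧
      -- For negative `y` the loop is not entered, and the final remainder is `y` itself.
      if 0 ≤ y then i + n = ⌊y⌋₊ else i = 0 ∧ n = 0) ?_ ?_
      (n := if 0 ≤ y then ⌊y⌋₊ else 0) ?_).mono ?_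
  · rintro s' ⟨-, -, -, -, i, -, h5, h6⟩
    simp only [Test.Holds, h5, not_le]
    split_ifs at h6 with h
    · have := Nat.lt_floor_add_one y
      simp only [add_zero] at h6
      rw [← h6] at this
      linarith
    · simp [h6.1]; linarith
  · rintro n s' ⟨h1, h2, h3, h4, i, h5, h6, h7⟩
    simp only [Test.Holds, ensures_seq_eq, ensures_op_eq, Op.exec]
    split_ifs at h7 with h
    · have := Nat.floor_le h
      rw [← h7] at this
      push_cast at this
      refine ⟨by rw [h6]; linarith, by simp [h₂.symm, h1], fun k hk hk' => ?_,
        fun k hk => ?_, by simp [h4], i + 1, by simp [h5], ?_, ?_⟩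
      · simp [hk, h2 k hk hk']
      · simp [show k ≠ 0 by omega, h3 k hk]
      · simp [h6, h4]; ring
      · rw [if_pos h]; omega
    · exact h7.2.elim
  · simp only [Op.exec]
    refine ⟨by simp [h₂.symm], fun k hk hk' => by simp [hk, hk'], fun k hk => ?_, by simp, 0,
      by simp, ?_, ?_⟩
    · simp [show k ≠ 0 by omega, show k ≠ 1 by omega]
    · simp [h₁, hy]
    · split_ifs <;> simp
  · rintro s' ⟨h1, h2, h3, h4, i, h5, h6, h7⟩
    have e0 : s'.Z 0 + s'.Z 1 = y - i := by rw [h6, h4]; ring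
    have hnat : y = ⌊y⌋₊ → i = ⌊y⌋₊ := by
      intro h
      have : 0 ≤ y := by rw [h]; positivity
      rw [if_pos this] at h7
      omega
    refine ensures_ite (fun ht => ensures_ite (fun ht' => ?_) fun ht' => ?_) fun ht => ?_
    · simp only [Test.Holds, Op.exec] at ht ht'
      simp [e0] at ht ht'
      have hyi : y = i := le_antisymm (by linarith) (by linarith)
      refine ensures_op ⟨?_, ?_, fun k hk hk' => ?_, fun k hk => ?_⟩
      · simp [Op.exec, h5, hyi, natCode_natCast]
      · simp [Op.exec, h₂.symm, h1]
      · simp [Op.exec, hk, h2 k hk hk']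
      · simp [Op.exec, show k ≠ 0 by omega, show k ≠ 2 by omega, h3 k hk]
    -- In both remaining cases a sign test failed, so the remainder is nonzero and `y` is not a
    -- natural number.
    all_goals
      have hne : ¬ y = ⌊y⌋₊ := by
        intro h
        have h' : y = i := by rw [hnat h]; exact h
        simp only [Test.Holds, Op.exec] at ht
        try simp only [Test.Holds, Op.exec] at ht'
        simp [e0, h'] at *
      refine ensures_op ⟨?_, ?_, fun k hk hk' => ?_, fun k hk => ?_⟩
      · simp [Op.exec, natCode, hne]
      · simp [Op.exec, h₂.symm, h1]
      · simp [Op.exec, hk, h2 k hk hk']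
      · simp [Op.exec, show k ≠ 0 by omega, show k ≠ 2 by omega, h3 k hk]

end Prog

end AddBSS

/-! ### Storing, reading and rewriting the input; reductions by primitive recursive functions -/

namespace AddBSS

open Encodable

/-- The real number for a bit. -/
noncomputable def bitReal (b : Bool) : ℝ := if b then 1 else 0

namespace Prog

/-- The tuple `z` is stored beginning with the register of address `z.length + 4`; its length is in
the first index register and the number `1` is in the index register with the number `4`. -/
def Loaded (z : Tuple) (s : Mem) : Prop :=
  s.I 0 = z.length ∧ s.I 4 = 1 ∧ ∀ i, i < z.length → s.Z (z.length + 3 + i) = z.getD i 0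

/-- A program that stores the input at the place where `Loaded` expects it. -/
theorem exists_load : ∃ p : Prog, p.NoQuery ∧ ∀ (O : Set Tuple) (z : Tuple), z ≠ [] →
    p.Ensures O (Loaded z) ⟨fun _ => z.length, fun i => z.getD i 0⟩ := by
  -- Register content `c` represents `c - 1`. Applied to the content `z.length`, `n + 1` gives the
  -- end address `z.length + 1` of the source, and `n + 4` below gives the target address `z.length
  -- + 4`, beyond the input and the three scratch registers.
  obtain ⟨p, hp, hps⟩ := exists_computes₁ (f := fun n => n + 1) Primrec.succ 11 0 3 (by omega)
    (by omega)
  obtain ⟨q, hq, hqs⟩ := exists_computes₁ (f := fun n => n + 4)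
    (Primrec.nat_add.comp .id (.const 4)) 11 0 2 (by omega) (by omega)
  refine ⟨seq (op (.idxOne 4)) (seq (op (.idxOne 1)) (seq p (seq q (copyBlock 1 2 3)))),
    ⟨trivial, trivial, hp, hq, noQuery_copyBlock _ _ _⟩, fun O z hz => ?_⟩
  have hl : 1 ≤ z.length := List.length_pos_iff.2 hz
  simp only [ensures_seq_eq, ensures_op_eq]
  refine (hps O _ (z.length - 1) ?_).mono fun s₁ ⟨hZ₁, h1, h2⟩ => (hqs O _ (z.length - 1) ?_).mono
    fun s₂ ⟨hZ₂, h3, h4⟩ => (ensures_copyBlock (a := 0) (b := z.length + 3) (n := z.length)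
      (by omega) (by omega) (by omega) ?_ ?_ ?_ ?_).mono fun s₃ ⟨h5, h6, h7⟩ => ⟨?_, ?_, ?_⟩
  · simp [Op.exec]; omega
  · rw [h2 _ (by omega) (by omega)]; simp [Op.exec]; omega
  · rw [h4 _ (by omega) (by omega), h2 _ (by omega) (by omega)]; simp [Op.exec]
  · rw [h3]; omega
  · rw [h4 _ (by omega) (by omega), h1]; omega
  · intro i j _ _; omega
  · rw [h6 _ (by omega) (by omega), h4 _ (by omega) (by omega), h2 _ (by omega) (by omega)]
    simp [Op.exec]
  · rw [h6 _ (by omega) (by omega), h4 _ (by omega) (by omega), h2 _ (by omega) (by omega)]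
    simp [Op.exec]
  · intro i hi
    rw [h7, if_pos (by omega), hZ₂, hZ₁]
    simp [Op.exec]

/-- A program that computes the list of the numbers `natCode y` for the entries `y` of the
tuple. -/
theorem exists_readCodes : ∃ p : Prog, p.NoQuery ∧ ∀ (O : Set Tuple) (z : Tuple) (s : Mem), z ≠ [] →
    Loaded z s → p.Ensures O (fun s' => Loaded z s' ∧ s'.I 6 = encode (z.map natCode) + 1) s := by
  obtain ⟨p, hp, hps⟩ := exists_computes₁ (f := fun n => n + 4)
    (Primrec.nat_add.comp .id (.const 4)) 11 0 1 (by omega) (by omega)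
  -- With `n = z.length - 1` the register receives `2 * z.length + 4`, the address after the stored
  -- block.
  obtain ⟨q, hq, hqs⟩ := exists_computes₁ (f := fun n => n + n + 5)
    (Primrec.nat_add.comp (Primrec.nat_add.comp .id .id) (.const 5)) 11 0 3 (by omega) (by omega)
  obtain ⟨c, hc, hcs⟩ := exists_program₂ (f := fun (l : List ℕ) (n : ℕ) => l ++ [n])
    Primrec.list_concat 11 6 5 6 (by omega) (by omega) (by omega)
  refine ⟨seq p (seq q (seq (op (.idxOne 6)) (loop (.idxNe 1 3) (seq (readNat 1 5 4) (seq c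
    (op (.idxSucc 1))))))), ⟨hp, hq, trivial, by simp, noQuery_readNat _ _ _, hc, trivial⟩,
    fun O z s hz hs => ?_⟩
  have hl : 1 ≤ z.length := List.length_pos_iff.2 hz
  obtain ⟨hs0, hs1, hs2⟩ := hs
  simp only [ensures_seq_eq, ensures_op_eq]
  refine (hps O _ (z.length - 1) (by omega)).mono fun s₁ ⟨hZ₁, h1, h2⟩ =>
    (hqs O _ (z.length - 1) ?_).mono fun s₂ ⟨hZ₂, h3, h4⟩ =>
    (ensures_loop (fun n s' => Loaded z s' ∧ s'.I 3 = 2 * z.length + 4 ∧ ∃ i, i + n = z.length ∧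
      s'.I 1 = z.length + 3 + i + 1 ∧ s'.I 6 = encode ((z.take i).map natCode) + 1) ?_ ?_
      (n := z.length) ?_).mono ?_
  · rw [h2 _ (by omega) (by omega)]; omega
  · rintro s' ⟨-, h5, i, hi, h6, -⟩
    simp only [Test.Holds, h5, h6]; omega
  · rintro n s' ⟨⟨h7, h8, h9⟩, h5, i, hi, h6, h10⟩
    refine ⟨by simp only [Test.Holds, h5, h6]; omega, ?_⟩
    simp only [ensures_seq_eq, ensures_op_eq]
    have hi' : i < z.length := by omega
    refine (ensures_readNat (by omega) (by omega)).mono fun s₃ ⟨h11, h12, h13, h14⟩ =>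
      (hcs O s₃ ((z.take i).map natCode) (natCode (s'.Z (s'.I 1 - 1))) ?_ h11).mono
        fun s₄ ⟨hZ₄, h15, h16⟩ => ⟨⟨?_, ?_, ?_⟩, ?_, i + 1, by omega, ?_, ?_⟩
    · rw [h13 _ (by omega) (by omega), h10]
    · simp only [Op.exec, ne_eq, zero_ne_one, not_false_eq_true, Function.update_of_ne]
      rw [h16 _ (by omega) (by omega), h13 _ (by omega) (by omega), h7]
    · simp only [Op.exec, ne_eq, OfNat.ofNat_ne_one, not_false_eq_true, Function.update_of_ne]
      rw [h16 _ (by omega) (by omega), h12]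
    · intro j hj
      rw [← h9 j hj]
      simp only [Op.exec, hZ₄]
      exact h14 _ (by omega)
    · simp only [Op.exec, ne_eq, OfNat.ofNat_ne_one, not_false_eq_true, Function.update_of_ne]
      rw [h16 _ (by omega) (by omega), h13 _ (by omega) (by omega), h5]
    · simp only [Op.exec, Function.update_self]
      rw [h16 _ (by omega) (by omega), h13 _ (by omega) (by omega), h6]
      omega
    · simp only [Op.exec, ne_eq, OfNat.ofNat_ne_one, not_false_eq_true, Function.update_of_ne]
      rw [h15, List.take_add_one, List.map_append, h6, Nat.add_sub_cancel, h9 i hi']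
      simp [hi']
  · refine ⟨⟨?_, ?_, ?_⟩, ?_, 0, by omega, ?_, by simp [Op.exec]⟩
    · simp only [Op.exec, ne_eq, OfNat.zero_ne_ofNat, not_false_eq_true, Function.update_of_ne]
      rw [h4 _ (by omega) (by omega), h2 _ (by omega) (by omega), hs0]
    · rw [← hs1, ← h2 _ (by omega) (by omega), ← h4 _ (by omega) (by omega)]
      simp [Op.exec]
    · simpa [Op.exec, hZ₂, hZ₁] using hs2
    · simp [Op.exec, h3]; omega
    · simp [Op.exec, h4, h1]; omega
  · rintro s' ⟨h5, -, i, hi, -, h6⟩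
    obtain rfl : i = z.length := hi
    exact ⟨h5, by simpa using h6⟩

/-- A program that replaces the entries of the tuple from position `k` on by given bits and moves
the resulting tuple to the first registers. -/
theorem exists_rewrite : ∃ p : Prog, p.NoQuery ∧ ∀ (O : Set Tuple) (z : Tuple) (s : Mem) (k : ℕ)
    (l : List Bool), Loaded z s → 1 ≤ k → k ≤ z.length → s.I 7 = encode (some (k, l)) + 1 →
      p.Ensures O (fun s' => (List.range (s'.I 0)).map s'.Z = z.take k ++ l.map bitReal) s := by
  -- `I_9` receives the address of entry `k` of the stored tuple, where the new bits are to be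
  -- written.
  obtain ⟨p₁, hp₁, hps₁⟩ := exists_program₂
    (f := fun (n : ℕ) (o : Option (ℕ × List Bool)) => n + 4 + (o.getD (0, [])).1)
    (Primrec.nat_add.comp (Primrec.nat_add.comp .fst (.const 4))
      (Primrec.fst.comp (Primrec.option_getD.comp .snd (.const _)))) 11 0 7 8 (by omega) (by omega)
    (by omega)
  obtain ⟨p₂, hp₂, hps₂⟩ := exists_program₁
    (f := fun (o : Option (ℕ × List Bool)) => (o.getD (0, [])).2)
    (Primrec.snd.comp (Primrec.option_getD.comp .id (.const _))) 11 7 9 (by omega) (by omega)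
  obtain ⟨p₃, hp₃, hps₃⟩ := exists_program₁ (f := fun l : List Bool => l.headI)
    Primrec.list_headI 11 9 10 (by omega) (by omega)
  obtain ⟨p₄, hp₄, hps₄⟩ := exists_program₁ (f := fun l : List Bool => l.tail)
    Primrec.list_tail 11 9 9 (by omega) (by omega)
  obtain ⟨p₅, hp₅, hps₅⟩ := exists_computes₁ (f := fun n => n + 4)
    (Primrec.nat_add.comp .id (.const 4)) 11 0 1 (by omega) (by omega)
  obtain ⟨p₆, hp₆, hps₆⟩ := exists_computes₁ (f := fun n => n - 1) Primrec.pred 11 2 0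
    (by omega) (by omega)
  -- The empty list and the bit `false` have encoding `0`, that is, register content `1`; comparison
  -- with register number `4` detects both.
  refine ⟨seq p₁ (seq p₂ (seq (loop (.idxNe 9 4) (seq p₃ (seq (ite (.idxEq 10 4) (op (.setZero 0))
    (op (.setOne 0))) (seq (op (.copy 8 4)) (seq (op (.idxSucc 8)) p₄))))) (seq p₅
    (seq (op (.idxOne 2)) (seq (copyBlock 1 2 8) p₆))))),
    ⟨hp₁, hp₂, ⟨by simp, hp₃, ⟨by simp, trivial, trivial⟩, trivial, trivial, hp₄⟩, hp₅, trivial,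
      noQuery_copyBlock _ _ _, hp₆⟩, fun O z s k l ⟨hs0, hs1, hs2⟩ hk hkl hs => ?_⟩
  simp only [ensures_seq_eq, ensures_op_eq]
  refine (hps₁ O s (z.length - 1) _ (by simp; omega) hs).mono fun s₁ ⟨hZ₁, h1, h2⟩ =>
    (hps₂ O s₁ (some (k, l)) (by rw [h2 _ (by omega) (by omega), hs])).mono
      fun s₂ ⟨hZ₂, h3, h4⟩ => ?_
  simp only [Option.getD_some, encode_nat] at h1 h3
  -- `l₁` has been written behind the first `k` entries, `l₂` is still to be written.
  refine (ensures_loop (fun n s' => s'.I 0 = z.length ∧ s'.I 4 = 1 ∧ ∃ l₁ l₂, l₁ ++ l₂ = l ∧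
    l₂.length = n ∧ s'.I 8 = z.length + 3 + (k + l₁.length) + 1 ∧ s'.I 9 = encode l₂ + 1 ∧
    ∀ i, i < k + l₁.length →
      s'.Z (z.length + 3 + i) = (z.take k ++ l₁.map bitReal).getD i 0) ?_ ?_ (n := l.length) ?_).mono
    fun s₃ ⟨h5, h6, l₁, l₂, h7, h8, h9, h10, h11⟩ => ?_
  · rintro s' ⟨h5, h6, l₁, l₂, h7, h8, h9, h10, -⟩
    rw [List.length_eq_zero_iff] at h8
    subst h8
    simp [Test.Holds, h10, h6]
  · rintro n s' ⟨h5, h6, l₁, l₂, h7, h8, h9, h10, h11⟩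
    obtain ⟨b, l₂, rfl⟩ := List.exists_cons_of_length_eq_add_one h8
    refine ⟨by simp [Test.Holds, h10, h6], ?_⟩
    simp only [ensures_seq_eq]
    refine (hps₃ O _ _ h10).mono fun s₃ ⟨hZ₃, h12, h13⟩ => ?_
    have hb : (ite (.idxEq 10 4) (op (.setZero 0)) (op (.setOne 0))).Ensures O
        (fun s' => s'.I = s₃.I ∧ s'.Z = Function.update s₃.Z 0 (bitReal b)) s₃ := by
      have h4' := h13 4 (by omega) (by omega)
      cases b
      · refine ensures_ite (fun _ => ensures_op ⟨rfl, rfl⟩) fun h => absurd ?_ h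
        simp [Test.Holds, h12, h4', h6]
      · refine ensures_ite (fun h => absurd h ?_) fun _ => ensures_op ⟨rfl, rfl⟩
        simp [Test.Holds, h12, h4', h6]
    refine hb.mono fun s₄ ⟨h14, h15⟩ => ?_
    simp only [ensures_op_eq]
    have e8 : s₄.I 8 = s'.I 8 := by rw [h14, h13 _ (by omega) (by omega)]
    refine (hps₄ O _ (b :: l₂) ?_).mono fun s₅ ⟨hZ₅, h16, h17⟩ =>
      ⟨?_, ?_, l₁ ++ [b], l₂, ?_, ?_, ?_, ?_, ?_⟩
    · simp only [Op.exec, ne_eq, Nat.reduceEqDiff, not_false_eq_true, Function.update_of_ne]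
      rw [h14, h13 _ (by omega) (by omega), h10]
    · rw [h17 _ (by omega) (by omega)]
      simp [Op.exec, h14, h13, h5]
    · rw [h17 _ (by omega) (by omega)]
      simp [Op.exec, h14, h13, h6]
    · simpa using h7
    · simpa using h8
    · rw [h17 _ (by omega) (by omega)]
      simp [Op.exec, e8, h9]; omega
    · simpa using h16
    · intro i hi
      simp only [List.length_append, List.length_singleton] at hi
      have e4 : s₄.I 4 = 1 := by rw [h14, h13 _ (by omega) (by omega), h6]
      simp only [hZ₅, Op.exec, e8, h9, e4, Nat.add_sub_cancel, le_refl, tsub_eq_zero_of_le, h15,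
        Function.update_self, hZ₃]
      by_cases hi' : i = k + l₁.length
      · subst hi'
        rw [Function.update_self, List.map_append, ← List.append_assoc, List.getD_append_right]
        · simp [hkl]
        · simp [hkl]
      · rw [Function.update_of_ne (by omega), Function.update_of_ne (by omega), h11 i (by omega),
          List.map_append, ← List.append_assoc,
          List.getD_append (z.take k ++ l₁.map bitReal)]
        rw [List.length_append, List.length_take, List.length_map, min_eq_left hkl]; omega
  · refine ⟨?_, ?_, [], l, rfl, rfl, ?_, h3, ?_⟩
    · rw [h4 _ (by omega) (by omega), h2 _ (by omega) (by omega), hs0]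
    · rw [h4 _ (by omega) (by omega), h2 _ (by omega) (by omega), hs1]
    · rw [h4 _ (by omega) (by omega), h1, List.length_nil]; omega
    · intro i hi
      simp only [List.length_nil, add_zero] at hi
      rw [hZ₂, hZ₁, hs2 i (by omega)]
      simp [List.getD_eq_getElem?_getD, hi]
  · rw [List.length_eq_zero_iff] at h8
    subst h8
    obtain rfl : l₁ = l := by simpa using h7
    have hlen : (z.take k ++ l₁.map bitReal).length = k + l₁.length := by simp [hkl]
    refine (hps₅ O s₃ (z.length - 1) (by omega)).mono fun s₄ ⟨hZ₄, h12, h13⟩ =>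
      (ensures_copyBlock (a := z.length + 3) (b := 0) (n := k + l₁.length) (by omega) (by omega)
        (by omega) ?_ ?_ ?_ ?_).mono fun s₅ ⟨h14, h15, h16⟩ =>
        (hps₆ O s₅ (k + l₁.length) (by omega)).mono fun s₆ ⟨hZ₆, h17, h18⟩ => ?_
    · simp [Op.exec, h12]; omega
    · simp [Op.exec]
    · simp [Op.exec, h13, h9]
    · intro i j _ _; omega
    · rw [h17, show k + l₁.length - 1 + 1 = k + l₁.length by omega]
      refine List.ext_getElem (by simp [hkl]) fun i hi hi' => ?_
      rw [hlen] at hi'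
      simp only [List.getElem_map, List.getElem_range, hZ₆]
      rw [h16, if_pos (by omega)]
      simp only [Op.exec, hZ₄, Nat.sub_zero]
      rw [h11 i hi', List.getD_eq_getElem]

end Prog

/-- Reductions: from the numbers among its entries, one computes for a tuple `z` whether `z` is
rejected; if it is not rejected, then the last entries are replaced by new bits and the oracle is
queried. -/
theorem Easier.of_primrec {A B : Set Tuple} (F : List ℕ → Option (ℕ × List Bool)) (hF : Primrec F)
    (hk : ∀ L k l, F L = some (k, l) → 1 ≤ k ∧ k ≤ L.length)
    (hA : ∀ z : Tuple, z ≠ [] → (z ∈ A ↔ ∃ k l, F (z.map natCode) = some (k, l) ∧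
      z.take k ++ l.map bitReal ∈ B)) : Easier A B := by
  obtain ⟨p₁, -, hps₁⟩ := Prog.exists_load
  obtain ⟨p₂, -, hps₂⟩ := Prog.exists_readCodes
  obtain ⟨p₃, -, hps₃⟩ := Prog.exists_program₁ hF 11 6 7 (by omega) (by omega)
  obtain ⟨p₄, -, hps₄⟩ := Prog.exists_rewrite
  let accept : Prog := .seq (.op (.idxOne 0)) (.op (.setOne 0))
  let reject : Prog := .seq (.op (.idxOne 0)) (.op (.setZero 0))
  have haccept (O : Set Tuple) (s : Mem) :
      accept.Ensures O (fun s => (List.range (s.I 0)).map s.Z = [1]) s := by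
    simp [accept, Prog.ensures_seq_eq, Prog.ensures_op_eq, Op.exec]
  have hreject (O : Set Tuple) (s : Mem) :
      reject.Ensures O (fun s => (List.range (s.I 0)).map s.Z = [0]) s := by
    simp [reject, Prog.ensures_seq_eq, Prog.ensures_op_eq, Op.exec]
  -- `none` has encoding `0`, so equality with register number `4`, which contains `1`, means
  -- rejection.
  refine ⟨(Prog.seq p₁ (.seq p₂ (.seq p₃ (.ite (.idxEq 7 4) reject
    (.seq p₄ (.ite .query accept reject)))))).compile 0, Prog.compile_mem_orderOracleMachines _,
    fun z hz => ?_⟩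
  have key (y : Tuple) (h : ∀ s, Prog.Loaded z s → s.I 7 = encode (F (z.map natCode)) + 1 →
      (Prog.ite (.idxEq 7 4) reject (.seq p₄ (.ite .query accept reject))).Ensures B
        (fun s => (List.range (s.I 0)).map s.Z = y) s) :
      HaltsWith ((Prog.seq p₁ (.seq p₂ (.seq p₃ (.ite (.idxEq 7 4) reject
        (.seq p₄ (.ite .query accept reject)))))).compile 0) B z y := by
    apply Prog.Ensures.haltsWith
    simp only [Prog.ensures_seq_eq]
    refine (hps₁ B z hz).mono fun s₁ h1 => (hps₂ B z s₁ hz h1).mono fun s₂ ⟨⟨h2, h3, h4⟩, h5⟩ =>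
      (hps₃ B s₂ _ h5).mono fun s₃ ⟨hZ, h6, h7⟩ => h s₃ ⟨?_, ?_, ?_⟩ h6
    · rw [h7 _ (by omega) (by omega), h2]
    · rw [h7 _ (by omega) (by omega), h3]
    · rwa [hZ]
  rw [hA z hz]
  rcases hFz : F (z.map natCode) with _ | ⟨k, l⟩
  · refine ⟨by simp, fun _ => key _ fun s hs h7 => Prog.ensures_ite (fun _ => hreject B s)
      fun h => absurd ?_ h⟩
    simp [Test.Holds, hs.2.1, h7, hFz]
  · have hkl := hk _ _ _ hFz
    rw [List.length_map] at hkl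
    have key' (y : Tuple) (h : ∀ s : Mem, (List.range (s.I 0)).map s.Z = z.take k ++ l.map bitReal →
        (Prog.ite .query accept reject).Ensures B (fun s => (List.range (s.I 0)).map s.Z = y) s) :
        HaltsWith ((Prog.seq p₁ (.seq p₂ (.seq p₃ (.ite (.idxEq 7 4) reject
          (.seq p₄ (.ite .query accept reject)))))).compile 0) B z y := by
      refine key y fun s hs h7 => Prog.ensures_ite (fun h => absurd h ?_) fun _ => ?_
      · simp [Test.Holds, hs.2.1, h7, hFz]
      · exact Prog.ensures_seq ((hps₄ B z s k l hs hkl.1 hkl.2 (by rw [h7, hFz])).mono h)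
    constructor
    · rintro ⟨k', l', h, hB⟩
      simp only [Option.some.injEq, Prod.mk.injEq] at h
      obtain ⟨rfl, rfl⟩ := h
      exact key' _ fun s hs => Prog.ensures_ite (fun _ => haccept B s) fun h =>
        absurd (by simpa [Test.Holds, hs] using hB) h
    · intro h
      exact key' _ fun s hs => Prog.ensures_ite
        (fun h' => absurd ⟨k, l, rfl, by simpa [Test.Holds, hs] using h'⟩ h) fun _ => hreject B s

end AddBSS

namespace AddBSS

/-! ### Replacing equality tests by order tests -/

/-- Thirteen instructions that have the effect of the instruction `c` with label `p` and do not use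
equality tests on real registers; the label `l` becomes the label `13 * l`. The effect of the
instructions `Z_b := Z_b - Z_a; Z_a := Z_a + Z_b; Z_b := Z_b - Z_a` is `(Z_a, Z_b) := (Z_b, -Z_a)`. -/
def eqBlock (p : ℕ) : Instr → List Instr
  -- `Z_j = 0` is tested as `Z_j ≥ 0` and `-Z_j ≥ 0`. Because of indirect addressing no register is
  -- known to be free, so `-Z_j` is produced inside the pair `(Z_j, Z_(j+1))` by an invertible map,
  -- which both branches undo.
  | .ifZero j l₁ l₂ => [.ifNonneg j (13 * p + 1) (13 * l₂),
      .sub (j + 1) (j + 1) j, .add j j (j + 1), .sub (j + 1) (j + 1) j,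
      .ifNonneg (j + 1) (13 * p + 5) (13 * p + 9),
      .add (j + 1) (j + 1) j, .sub j j (j + 1), .add (j + 1) (j + 1) j,
      .ifIdxEq 0 0 (13 * l₁) (13 * l₁),
      .add (j + 1) (j + 1) j, .sub j j (j + 1), .add (j + 1) (j + 1) j,
      .ifIdxEq 0 0 (13 * l₂) (13 * l₂)]
  | .ifIdxEq j k l₁ l₂ => .ifIdxEq j k (13 * l₁) (13 * l₂) :: List.replicate 12 (.copy 0 0)
  | c => c :: List.replicate 12 (.copy 0 0)

theorem length_eqBlock (p : ℕ) (c : Instr) : (eqBlock p c).length = 13 := by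
  cases c <;> simp [eqBlock]

/-- A machine with order tests that simulates a machine with equality tests. -/
def orderForm (M : Machine) : Machine :=
  (List.range M.length).flatMap fun p => (M[p]?).elim [] (eqBlock p)

theorem length_flatMap_range {α : Type*} {f : ℕ → List α} {m n : ℕ}
    (hf : ∀ p, p < n → (f p).length = m) : ((List.range n).flatMap f).length = m * n := by
  induction n with
  | zero => simp
  | succ n ih =>
    rw [List.range_succ, List.flatMap_append, List.length_append, ih fun p hp => hf p (by omega)]
    simp [hf n (by omega), Nat.mul_succ]

theorem getElem?_flatMap_range {α : Type*} {f : ℕ → List α} {m n : ℕ}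
    (hf : ∀ p, p < n → (f p).length = m) {p i : ℕ} (hp : p < n) (hi : i < m) :
    ((List.range n).flatMap f)[m * p + i]? = (f p)[i]? := by
  induction n with
  | zero => omega
  | succ n ih =>
    have hlen := length_flatMap_range fun p (hp : p < n) => hf p (by omega)
    rw [List.range_succ, List.flatMap_append]
    rcases Nat.lt_succ_iff_lt_or_eq.1 hp with hp' | rfl
    · rw [List.getElem?_append_left, ih (fun p hp => hf p (by omega)) hp']
      rw [hlen]
      have := Nat.mul_le_mul_left m (Nat.succ_le_of_lt hp')
      rw [Nat.mul_succ] at this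
      omega
    · rw [List.getElem?_append_right (by omega), hlen]
      simp

theorem length_elim_eqBlock {M : Machine} {p : ℕ} (hp : p < M.length) :
    ((M[p]?).elim [] (eqBlock p)).length = 13 := by
  simp [hp, length_eqBlock]

theorem length_orderForm (M : Machine) : (orderForm M).length = 13 * M.length :=
  length_flatMap_range fun _ hp => length_elim_eqBlock hp

theorem getElem?_orderForm {M : Machine} {p : ℕ} {c : Instr} (h : M[p]? = some c) {i : ℕ}
    (hi : i < 13) : (orderForm M)[13 * p + i]? = (eqBlock p c)[i]? := by
  have hp := (List.getElem?_eq_some_iff.1 h).1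
  rw [orderForm, getElem?_flatMap_range (fun _ hp => length_elim_eqBlock hp) hp hi, h]
  rfl

theorem orderForm_mem_orderMachines {M : Machine} (hM : M ∈ EqMachines) :
    orderForm M ∈ OrderMachines := by
  intro c hc
  simp only [orderForm, List.mem_flatMap, List.mem_range] at hc
  obtain ⟨p, hp, hc⟩ := hc
  have h := hM M[p] (List.getElem_mem hp)
  rw [List.getElem?_eq_getElem hp] at hc
  generalize M[p] = c' at h hc
  revert c
  cases c' <;> simp_all [eqBlock, Instr.IsOrderTest, Instr.IsEqTest, Instr.IsQuery]

theorem exec_copy_self (O : Set Tuple) (p j : ℕ) (I : ℕ → ℕ) (Z : ℕ → ℝ) :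
    Instr.exec O ⟨p, I, Z⟩ (.copy j j) = ⟨p + 1, I, Z⟩ := by
  simp [Instr.exec]

theorem reaches_noops {M : Machine} {O : Set Tuple} {p n : ℕ} {I : ℕ → ℕ} {Z : ℕ → ℝ}
    (h : ∀ i, i < n → M[p + i]? = some (.copy 0 0)) : Reaches M O ⟨p, I, Z⟩ ⟨p + n, I, Z⟩ := by
  induction n with
  | zero => exact .refl _
  | succ n ih =>
    exact (ih fun i hi => h i (by omega)).trans (.of_step (h n (by omega)) (exec_copy_self ..))

/-- One step of a machine with equality tests is simulated by its order form. -/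
theorem reaches_orderForm {M : Machine} (hM : M ∈ EqMachines) {O : Set Tuple} {s : Config}
    (hs : s.pc < M.length) : Reaches (orderForm M) O (step (orderForm M) O ⟨13 * s.pc, s.I, s.Z⟩)
      ⟨13 * (step M O s).pc, (step M O s).I, (step M O s).Z⟩ := by
  obtain ⟨p, I, Z⟩ := s
  obtain ⟨c, hc⟩ : ∃ c, M[p]? = some c := ⟨_, List.getElem?_eq_getElem hs⟩
  have h := hM c (List.mem_of_getElem? hc)
  have hb (i : ℕ) (hi : i < 13) := getElem?_orderForm hc hi
  rw [step_of_getElem? (c := ⟨p, I, Z⟩) hc]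
  -- Instructions without a jump are followed by twelve idle instructions, which lead to the next
  -- block.
  have simple (c' : Instr) (hp' : ∀ p' I Z, c'.exec O ⟨p', I, Z⟩ = ⟨p' + 1,
        (c'.exec O ⟨0, I, Z⟩).I, (c'.exec O ⟨0, I, Z⟩).Z⟩)
      (hc' : eqBlock p c' = c' :: List.replicate 12 (.copy 0 0)) (h : c = c') :
      Reaches (orderForm M) O (step (orderForm M) O ⟨13 * p, I, Z⟩)
        ⟨13 * (c.exec O ⟨p, I, Z⟩).pc, (c.exec O ⟨p, I, Z⟩).I, (c.exec O ⟨p, I, Z⟩).Z⟩ := by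
    subst h
    have h0 := hb 0 (by omega)
    rw [hc'] at h0
    rw [step_of_getElem? h0, hp', hp' p]
    refine reaches_noops (n := 12) fun i hi => ?_
    rw [add_assoc, hb _ (by omega), hc', add_comm 1, List.getElem?_cons_succ,
      List.getElem?_replicate, if_pos hi]
  cases c with
  | ifNonneg j l₁ l₂ => exact absurd trivial h.1
  | query l₁ l₂ => exact absurd trivial h.2
  | ifIdxEq j k l₁ l₂ =>
    rw [step_of_getElem? (hb 0 (by omega))]
    simp only [Instr.exec]
    split_ifs <;> exact .refl _
  | ifZero j l₁ l₂ =>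
    rw [step_of_getElem? (hb 0 (by omega))]
    simp only [Instr.exec]
    have key (l l' : ℕ) (hl : l = if 0 ≤ -Z j then 5 else 9)
        (h1 : (orderForm M)[13 * p + l]? = some (.add (j + 1) (j + 1) j))
        (h2 : (orderForm M)[13 * p + l + 1]? = some (.sub j j (j + 1)))
        (h3 : (orderForm M)[13 * p + l + 1 + 1]? = some (.add (j + 1) (j + 1) j))
        (h4 : (orderForm M)[13 * p + l + 1 + 1 + 1]? =
          some (.ifIdxEq 0 0 (13 * l') (13 * l'))) :
        Reaches (orderForm M) O ⟨13 * p + 1, I, Z⟩ ⟨13 * l', I, Z⟩ := by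
      refine (Reaches.of_step (hb 1 (by omega)) rfl).trans <|
        (Reaches.of_step (hb 2 (by omega)) rfl).trans <|
        (Reaches.of_step (hb 3 (by omega)) rfl).trans <|
        (Reaches.of_step (c' := ⟨13 * p + l, I, Function.update (Function.update Z j (Z (j + 1)))
          (j + 1) (- Z j)⟩) (hb 4 (by omega)) ?_).trans <|
        (Reaches.of_step (i := .add (j + 1) (j + 1) j) h1 rfl).trans <|
        (Reaches.of_step (i := .sub j j (j + 1)) h2 rfl).trans <|
        (Reaches.of_step (i := .add (j + 1) (j + 1) j) h3 rfl).trans <| .of_step h4 ?_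
      · simp only [Instr.exec, Config.mk.injEq, true_and]
        refine ⟨?_, ?_⟩
        · rw [hl]
          simp only [Function.update_self, ne_eq, Nat.left_eq_add, Nat.succ_ne_self, one_ne_zero,
            not_false_eq_true, Function.update_of_ne]
          rw [show Z (j + 1) - Z j - (Z j + (Z (j + 1) - Z j)) = - Z j by ring]
          split_ifs <;> rfl
        · funext r
          by_cases h₁ : r = j
          · subst h₁; simp
          · by_cases h₂ : r = j + 1
            · subst h₂; simp
            · simp [h₁, h₂]
      · simp only [Instr.exec, Config.mk.injEq, true_and, if_true]
        funext r
        by_cases h₁ : r = j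
        · subst h₁; simp
        · by_cases h₂ : r = j + 1
          · subst h₂; simp
          · simp [h₁, h₂]
    rcases lt_trichotomy (Z j) 0 with hZ | hZ | hZ
    · rw [if_neg (not_le.2 hZ), if_neg hZ.ne]
      exact .refl _
    · rw [if_pos hZ.ge, if_pos hZ]
      exact key 5 l₁ (by simp [hZ]) (hb 5 (by omega)) (hb 6 (by omega)) (hb 7 (by omega))
        (hb 8 (by omega))
    · rw [if_pos hZ.le, if_neg hZ.ne']
      exact key 9 l₂ (by simp [hZ]) (hb 9 (by omega)) (hb 10 (by omega)) (hb 11 (by omega))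
        (hb 12 (by omega))
  | _ => exact simple _ (fun _ _ _ => rfl) rfl rfl

/-- Halting is transferred step by step. For the converse, the images of never halting
configurations form a recurring set; it matters that `reaches_orderForm` starts after one genuine
step of the simulation. -/
theorem halts_orderForm_iff {M : Machine} (hM : M ∈ EqMachines) {O : Set Tuple} {x : Tuple} :
    Halts (orderForm M) O x ↔ Halts M O x := by
  constructor
  · rintro ⟨t, ht⟩
    by_contra h
    have hN : NeverHalts M O (start x) := by
      intro t
      by_contra! ht
      exact h ⟨t, ht⟩
    refine absurd ht (not_le.2 (NeverHalts.of_invariant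
      {c | ∃ s, NeverHalts M O s ∧ c = ⟨13 * s.pc, s.I, s.Z⟩} ?_ ⟨start x, hN, rfl⟩ t))
    rintro _ ⟨s, hs, rfl⟩
    have h0 : s.pc < M.length := hs 0
    refine ⟨?_, _, ⟨step M O s, fun t => ?_, rfl⟩, reaches_orderForm hM h0⟩
    · simp only [length_orderForm]; omega
    · rw [← Function.iterate_succ_apply]
      exact hs (t + 1)
  · rintro ⟨t, ht⟩
    have h (n : ℕ) : Reaches (orderForm M) O (start x)
        ⟨13 * (run M O x n).pc, (run M O x n).I, (run M O x n).Z⟩ := by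
      induction n with
      | zero => exact .refl _
      | succ n ih =>
        rw [run, Function.iterate_succ_apply', ← run]
        rcases lt_or_ge (run M O x n).pc M.length with hn | hn
        · refine ih.trans (Reaches.trans ⟨1, rfl⟩ (reaches_orderForm hM hn))
        · rwa [step_of_le hn]
    obtain ⟨t', ht'⟩ := h t
    refine ⟨t', ?_⟩
    rw [run, ht', length_orderForm]
    exact Nat.mul_le_mul_left 13 ht

end AddBSS

namespace AddBSS

/-! ### Codes of machines as data -/

/-- The number of an instruction and the list of its arguments. -/
abbrev RawInstr : Type := ℕ × List ℕ

/-- The data of an instruction. -/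
def Instr.raw : Instr → RawInstr
  | .add i j k => (0, [i, j, k])
  | .sub i j k => (1, [i, j, k])
  | .setZero j => (2, [j])
  | .setOne j => (3, [j])
  | .ifZero j l₁ l₂ => (4, [j, l₁, l₂])
  | .ifNonneg j l₁ l₂ => (5, [j, l₁, l₂])
  | .copy j k => (6, [j, k])
  | .idxOne j => (7, [j])
  | .idxSucc j => (8, [j])
  | .ifIdxEq j k l₁ l₂ => (9, [j, k, l₁, l₂])
  | .query l₁ l₂ => (10, [l₁, l₂])

/-- The codes of the names of the instructions. -/
def opBits : List (List Bool) :=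
  [Symb.add, .sub, .setZero, .setOne, .ifZero, .ifNonneg, .copy, .idxOne, .idxSucc, .ifIdxEq,
    .query].map Symb.bits

/-- The code of a number. -/
def numBits (n : ℕ) : List Bool := (List.range n).flatMap (fun _ => Symb.tally.bits) ++ Symb.sep.bits

/-- The code of an instruction that is given by its data. -/
def RawInstr.bits (r : RawInstr) : List Bool := opBits.getD r.1 [] ++ r.2.flatMap numBits

/-- The code of a program that is given by its data. -/
def rawBits (m : List RawInstr) : List Bool := m.flatMap RawInstr.bits ++ Symb.endmark.bits

theorem flatMap_bits_numeral (n : ℕ) : (numeral n).flatMap Symb.bits = numBits n := by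
  rw [numeral, numBits, List.flatMap_append, List.flatMap_singleton]
  congr 1
  induction n with
  | zero => rfl
  | succ n ih =>
    rw [List.replicate_succ', List.range_succ, List.flatMap_append, List.flatMap_append, ih]
    rfl

theorem flatMap_bits_symbols (c : Instr) : c.symbols.flatMap Symb.bits = RawInstr.bits c.raw := by
  cases c <;> simp [Instr.symbols, Instr.raw, RawInstr.bits, flatMap_bits_numeral, opBits]

theorem codeBits_eq (M : Machine) : codeBits M = rawBits (M.map Instr.raw) := by
  simp [codeBits, rawBits, List.flatMap_assoc, List.flatMap_map, flatMap_bits_symbols]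

theorem code_eq (M : Machine) : code M = (codeBits M).map bitReal := rfl

/-! ### Decoding -/

/-- The state of a decoder that reads a code from its end: the bits of the incomplete symbol, the
arguments read since the last name of an instruction, and the complete instructions. -/
abbrev DecoderState : Type := List Bool × List ℕ × List RawInstr

/-- Processing of a symbol. -/
def decodeSymb (w : List Bool) (s : List ℕ × List RawInstr) : List ℕ × List RawInstr :=
  if w = Symb.sep.bits then (0 :: s.1, s.2)
  else if w = Symb.tally.bits then ((s.1.headI + 1) :: s.1.tail, s.2)
  else if w = Symb.endmark.bits then s
  else ([], (opBits.findIdx (fun v => decide (v = w)), s.1) :: s.2)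

/-- Processing of a bit. -/
def decodeBit (b : Bool) (s : DecoderState) : DecoderState :=
  if s.1.length = 3 then ([], decodeSymb (b :: s.1) s.2) else (b :: s.1, s.2)

/-- The program with a given code. -/
def decodeBits (l : List Bool) : List RawInstr :=
  (l.foldr decodeBit ([], [], [])).2.2

theorem foldr_decodeBit_bits (t : Symb) (l : List Bool) {s : DecoderState} {a}
    (h : l.foldr decodeBit s = ([], a)) :
    (t.bits ++ l).foldr decodeBit s = ([], decodeSymb t.bits a) := by
  cases t <;> simp [Symb.bits, h, decodeBit]

theorem foldr_decodeBit_numBits (n : ℕ) (l : List Bool) {s : DecoderState} {a : List ℕ}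
    {m : List RawInstr} (h : l.foldr decodeBit s = ([], a, m)) :
    (numBits n ++ l).foldr decodeBit s = ([], n :: a, m) := by
  rw [← flatMap_bits_numeral]
  induction n with
  | zero => simpa [numeral, decodeSymb] using foldr_decodeBit_bits .sep l h
  | succ n ih =>
    have := foldr_decodeBit_bits .tally _ ih
    rw [numeral, List.replicate_succ, List.cons_append, ← numeral, List.flatMap_cons,
      List.append_assoc, this]
    simp [decodeSymb, Symb.bits]

theorem foldr_decodeBit_flatMap_numBits (v : List ℕ) (l : List Bool) {s : DecoderState}
    {m : List RawInstr} (h : l.foldr decodeBit s = ([], [], m)) :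
    (v.flatMap numBits ++ l).foldr decodeBit s = ([], v, m) := by
  induction v with
  | nil => simpa using h
  | cons n v ih =>
    rw [List.flatMap_cons, List.append_assoc]
    exact foldr_decodeBit_numBits n _ ih

theorem foldr_decodeBit_raw (c : Instr) (l : List Bool) {s : DecoderState}
    {m : List RawInstr} (h : l.foldr decodeBit s = ([], [], m)) :
    (RawInstr.bits c.raw ++ l).foldr decodeBit s = ([], [], c.raw :: m) := by
  have h' := foldr_decodeBit_flatMap_numBits c.raw.2 l h
  rw [RawInstr.bits, List.append_assoc]
  generalize c.raw.2.flatMap numBits ++ l = l' at h'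
  cases c <;> simp [Instr.raw, opBits, Symb.bits, h', decodeBit, decodeSymb, List.findIdx_cons]

/-- Reading from the end, the arguments of an instruction are complete when its name appears, so a
single right fold decodes. This left inverse also shows that the coding is unambiguous. -/
theorem decodeBits_codeBits (M : Machine) : decodeBits (codeBits M) = M.map Instr.raw := by
  have h : (codeBits M).foldr decodeBit ([], [], []) = ([], [], M.map Instr.raw) := by
    rw [codeBits_eq]
    induction M with
    | nil => rfl
    | cons c M ih =>
      rw [rawBits, List.map_cons, List.flatMap_cons, List.append_assoc]
      exact foldr_decodeBit_raw c _ ih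
  rw [decodeBits, h]

theorem Instr.raw_injective : Function.Injective Instr.raw := by
  intro c c' h
  cases c <;> cases c' <;> simp_all [Instr.raw]

theorem codeBits_injective : Function.Injective codeBits := by
  intro M M' h
  have := congrArg decodeBits h
  rw [decodeBits_codeBits, decodeBits_codeBits] at this
  exact Instr.raw_injective.list_map this

theorem bitReal_injective : Function.Injective bitReal := by
  intro b b' h
  cases b <;> cases b' <;> simp_all [bitReal]

/-! ### The transformation of codes -/

/-- The numbers of arguments of the instructions of machines with equality tests. -/
def arities : List (Option ℕ) :=
  [some 3, some 3, some 1, some 1, some 3, none, some 2, some 1, some 1, some 4, none]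

/-- The entries `none` at positions 5 and 10 exclude order tests and queries, so one table lookup
checks both well-formedness and the machine class. -/
theorem arities_getD_eq_iff (r : RawInstr) : arities.getD r.1 none = some r.2.length ↔
    ∃ c : Instr, ¬ c.IsOrderTest ∧ ¬ c.IsQuery ∧ c.raw = r := by
  constructor
  · obtain ⟨o, v⟩ := r
    intro h
    have ho : o < 11 := by
      by_contra! ho
      simp [arities, List.getElem?_eq_none (show [some 3, some 3, some 1, some 1, some 3, none,
        some 2, some 1, some 1, some 4, none].length ≤ o from ho)] at h
    interval_cases o <;> simp [arities] at h
    · obtain ⟨i, j, k, rfl⟩ := List.length_eq_three.1 h.symm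
      exact ⟨.add i j k, by simp [Instr.IsOrderTest], by simp [Instr.IsQuery], rfl⟩
    · obtain ⟨i, j, k, rfl⟩ := List.length_eq_three.1 h.symm
      exact ⟨.sub i j k, by simp [Instr.IsOrderTest], by simp [Instr.IsQuery], rfl⟩
    · obtain ⟨j, rfl⟩ := List.length_eq_one_iff.1 h.symm
      exact ⟨.setZero j, by simp [Instr.IsOrderTest], by simp [Instr.IsQuery], rfl⟩
    · obtain ⟨j, rfl⟩ := List.length_eq_one_iff.1 h.symm
      exact ⟨.setOne j, by simp [Instr.IsOrderTest], by simp [Instr.IsQuery], rfl⟩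
    · obtain ⟨i, j, k, rfl⟩ := List.length_eq_three.1 h.symm
      exact ⟨.ifZero i j k, by simp [Instr.IsOrderTest], by simp [Instr.IsQuery], rfl⟩
    · obtain ⟨i, j, rfl⟩ := List.length_eq_two.1 h.symm
      exact ⟨.copy i j, by simp [Instr.IsOrderTest], by simp [Instr.IsQuery], rfl⟩
    · obtain ⟨j, rfl⟩ := List.length_eq_one_iff.1 h.symm
      exact ⟨.idxOne j, by simp [Instr.IsOrderTest], by simp [Instr.IsQuery], rfl⟩
    · obtain ⟨j, rfl⟩ := List.length_eq_one_iff.1 h.symm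
      exact ⟨.idxSucc j, by simp [Instr.IsOrderTest], by simp [Instr.IsQuery], rfl⟩
    · obtain ⟨a, v, rfl⟩ := List.exists_cons_of_length_eq_add_one h.symm
      obtain ⟨i, j, k, rfl⟩ := List.length_eq_three.1 (show v.length = 3 by simpa using h.symm)
      exact ⟨.ifIdxEq a i j k, by simp [Instr.IsOrderTest], by simp [Instr.IsQuery], rfl⟩
  · rintro ⟨c, h, h', rfl⟩
    cases c <;> simp_all [Instr.raw, arities, Instr.IsOrderTest, Instr.IsQuery]

theorem forall_arities_iff (m : List RawInstr) :
    (∀ r ∈ m, arities.getD r.1 none = some r.2.length) ↔ ∃ M ∈ EqMachines, M.map Instr.raw = m := by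
  constructor
  · intro h
    induction m with
    | nil => exact ⟨[], by simp [EqMachines], rfl⟩
    | cons r m ih =>
      obtain ⟨M, hM, rfl⟩ := ih fun r hr => h r (List.mem_cons_of_mem _ hr)
      obtain ⟨c, h₁, h₂, rfl⟩ := (arities_getD_eq_iff r).1 (h r List.mem_cons_self)
      refine ⟨c :: M, ?_, rfl⟩
      rintro c' (_ | ⟨_, hc'⟩)
      exacts [⟨h₁, h₂⟩, hM c' hc']
  · rintro ⟨M, hM, rfl⟩ r hr
    obtain ⟨c, hc, rfl⟩ := List.mem_map.1 hr
    exact (arities_getD_eq_iff _).2 ⟨c, (hM c hc).1, (hM c hc).2, rfl⟩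

/-- The data of the instructions of `eqBlock`. -/
def rawEqBlock (p : ℕ) (r : RawInstr) : List RawInstr :=
  let a := r.2.getD 0 0
  let b := r.2.getD 1 0
  let c := r.2.getD 2 0
  if r.1 = 4 then
    [(5, [a, 13 * p + 1, 13 * c]),
      (1, [a + 1, a + 1, a]), (0, [a, a, a + 1]), (1, [a + 1, a + 1, a]),
      (5, [a + 1, 13 * p + 5, 13 * p + 9]),
      (0, [a + 1, a + 1, a]), (1, [a, a, a + 1]), (0, [a + 1, a + 1, a]),
      (9, [0, 0, 13 * b, 13 * b]),
      (0, [a + 1, a + 1, a]), (1, [a, a, a + 1]), (0, [a + 1, a + 1, a]),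
      (9, [0, 0, 13 * c, 13 * c])]
  else if r.1 = 9 then
    (9, [a, b, 13 * c, 13 * r.2.getD 3 0]) :: List.replicate 12 (6, [0, 0])
  else r :: List.replicate 12 (6, [0, 0])

theorem rawEqBlock_raw (p : ℕ) (c : Instr) :
    rawEqBlock p c.raw = (eqBlock p c).map Instr.raw := by
  cases c <;> simp [rawEqBlock, eqBlock, Instr.raw]

/-- The data of the instructions of `orderForm`. -/
def rawOrderForm (m : List RawInstr) : List RawInstr :=
  (List.range m.length).flatMap fun p => (m[p]?).elim [] (rawEqBlock p)

theorem rawOrderForm_raw (M : Machine) :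
    rawOrderForm (M.map Instr.raw) = (orderForm M).map Instr.raw := by
  rw [rawOrderForm, orderForm, List.map_flatMap, List.length_map]
  congr 1
  funext p
  rw [List.getElem?_map]
  cases M[p]? <;> simp [rawEqBlock_raw]

/-- The code of the order form of the machine with the code `l`, for machines with equality
tests. -/
def transformBits (l : List Bool) : Option (List Bool) :=
  if (∀ r ∈ decodeBits l, arities.getD r.1 none = some r.2.length) ∧ rawBits (decodeBits l) = l then
    some (rawBits (rawOrderForm (decodeBits l)))
  else none

/-- The decoder returns something for every bit string; encoding its result again and comparing
filters out the strings that are not codes. -/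
theorem transformBits_eq_some_iff {l l' : List Bool} : transformBits l = some l' ↔
    ∃ M ∈ EqMachines, codeBits M = l ∧ codeBits (orderForm M) = l' := by
  unfold transformBits
  constructor
  · intro h
    split_ifs at h with h'
    obtain ⟨hw, h'⟩ := h'
    obtain ⟨M, hM, hd⟩ := (forall_arities_iff _).1 hw
    refine ⟨M, hM, ?_, ?_⟩
    · rw [codeBits_eq, hd, h']
    · rw [codeBits_eq, ← rawOrderForm_raw, hd]
      exact Option.some_injective _ h
  · rintro ⟨M, hM, rfl, rfl⟩
    rw [if_pos, decodeBits_codeBits, rawOrderForm_raw, ← codeBits_eq]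
    exact ⟨(forall_arities_iff _).2 ⟨M, hM, (decodeBits_codeBits M).symm⟩,
      by rw [decodeBits_codeBits, ← codeBits_eq]⟩

/-! ### Primitive recursiveness -/

section

open Primrec

theorem primrec_numBits : Primrec numBits :=
  list_append.comp (list_flatMap list_range (Primrec.const _).to₂) (.const _)

theorem primrec_rawInstr_bits : Primrec RawInstr.bits :=
  list_append.comp ((list_getD []).comp (.const _) .fst)
    (list_flatMap .snd (primrec_numBits.comp .snd).to₂)

theorem primrec_rawBits : Primrec rawBits :=
  list_append.comp (list_flatMap .id (primrec_rawInstr_bits.comp .snd).to₂) (.const _)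

theorem primrec_decodeSymb : Primrec₂ decodeSymb := by
  have h (w : List Bool) : PrimrecPred fun p : List Bool × List ℕ × List RawInstr => p.1 = w :=
    Primrec.eq.comp .fst (.const w)
  refine Primrec.ite (h _) ?_ (Primrec.ite (h _) ?_ (Primrec.ite (h _) .snd ?_))
  · exact pair (list_cons.comp (.const 0) (fst.comp .snd)) (snd.comp .snd)
  · exact pair (list_cons.comp (succ.comp (list_headI.comp (fst.comp .snd)))
      (list_tail.comp (fst.comp .snd))) (snd.comp .snd)
  · exact pair (.const []) (list_cons.comp (pair (list_findIdx (.const opBits)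
      (Primrec.eq.comp .snd (fst.comp .fst)).decide.to₂) (fst.comp .snd)) (snd.comp .snd))

theorem primrec_decodeBit : Primrec₂ decodeBit := by
  refine Primrec.ite (Primrec.eq.comp (list_length.comp (fst.comp .snd)) (.const 3)) ?_ ?_
  · exact pair (.const []) (primrec_decodeSymb.comp (list_cons.comp .fst (fst.comp .snd))
      (snd.comp .snd))
  · exact pair (list_cons.comp .fst (fst.comp .snd)) (snd.comp .snd)

theorem primrec_decodeBits : Primrec decodeBits :=
  snd.comp (snd.comp (list_foldr .id (.const _) (primrec_decodeBit.comp (fst.comp .snd)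
    (snd.comp .snd)).to₂))

section

variable {α : Type*} [Primcodable α] {f g h k : α → ℕ}

theorem primrec_raw₃ (n : ℕ) (hf : Primrec f) (hg : Primrec g) (hh : Primrec h) :
    Primrec fun a => ((n, [f a, g a, h a]) : RawInstr) :=
  pair (.const n) (list_cons.comp hf (list_cons.comp hg (list_cons.comp hh (.const []))))

theorem primrec_raw₄ (n : ℕ) (hf : Primrec f) (hg : Primrec g) (hh : Primrec h) (hk : Primrec k) :
    Primrec fun a => ((n, [f a, g a, h a, k a]) : RawInstr) :=
  pair (.const n) (list_cons.comp hf (list_cons.comp hg (list_cons.comp hh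
    (list_cons.comp hk (.const [])))))

end

theorem primrec_rawEqBlock : Primrec₂ rawEqBlock := by
  have arg (i : ℕ) : Primrec fun q : ℕ × RawInstr => q.2.2.getD i 0 :=
    (list_getD 0).comp (snd.comp .snd) (.const i)
  have a := arg 0
  have a' : Primrec fun q : ℕ × RawInstr => q.2.2.getD 0 0 + 1 := succ.comp a
  have times {f : ℕ × RawInstr → ℕ} (hf : Primrec f) : Primrec fun q => 13 * f q :=
    nat_mul.comp (.const 13) hf
  have label (i : ℕ) : Primrec fun q : ℕ × RawInstr => 13 * q.1 + i :=
    nat_add.comp (times .fst) (.const i)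
  have hzero : Primrec fun _ : ℕ × RawInstr => 0 := .const 0
  have op (i : ℕ) : PrimrecPred fun q : ℕ × RawInstr => q.2.1 = i :=
    Primrec.eq.comp (fst.comp .snd) (.const i)
  refine Primrec.ite (op 4) ?_ (Primrec.ite (op 9) ?_ (list_cons.comp .snd (.const _)))
  · exact list_cons.comp (primrec_raw₃ 5 a (label 1) (times (arg 2))) <|
      list_cons.comp (primrec_raw₃ 1 a' a' a) <|
      list_cons.comp (primrec_raw₃ 0 a a a') <|
      list_cons.comp (primrec_raw₃ 1 a' a' a) <|
      list_cons.comp (primrec_raw₃ 5 a' (label 5) (label 9)) <|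
      list_cons.comp (primrec_raw₃ 0 a' a' a) <|
      list_cons.comp (primrec_raw₃ 1 a a a') <|
      list_cons.comp (primrec_raw₃ 0 a' a' a) <|
      list_cons.comp (primrec_raw₄ 9 hzero hzero (times (arg 1)) (times (arg 1))) <|
      list_cons.comp (primrec_raw₃ 0 a' a' a) <|
      list_cons.comp (primrec_raw₃ 1 a a a') <|
      list_cons.comp (primrec_raw₃ 0 a' a' a) <|
      list_cons.comp (primrec_raw₄ 9 hzero hzero (times (arg 2)) (times (arg 2))) (.const [])
  · exact list_cons.comp (primrec_raw₄ 9 a (arg 1) (times (arg 2)) (times (arg 3))) (.const _)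

theorem primrec_rawOrderForm : Primrec rawOrderForm := by
  refine list_flatMap (list_range.comp list_length) ?_
  have h : Primrec fun q : List RawInstr × ℕ => (q.1[q.2]?).elim [] (rawEqBlock q.2) := by
    refine (option_casesOn (o := fun q : List RawInstr × ℕ => q.1[q.2]?) (f := fun _ => [])
      (g := fun q r => rawEqBlock q.2 r) (list_getElem?.comp .fst .snd) (.const [])
      (primrec_rawEqBlock.comp (snd.comp .fst) .snd).to₂).of_eq fun q => ?_
    cases q.1[q.2]? <;> rfl
  exact h

theorem primrec_transformBits : Primrec transformBits := by
  have h : PrimrecPred fun r : RawInstr => arities.getD r.1 none = some r.2.length :=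
    Primrec.eq.comp ((list_getD none).comp (.const _) .fst) (option_some.comp (list_length.comp .snd))
  exact Primrec.ite ((h.forall_mem_list.comp primrec_decodeBits).and
    (Primrec.eq.comp (primrec_rawBits.comp primrec_decodeBits) .id))
    (option_some.comp (primrec_rawBits.comp (primrec_rawOrderForm.comp primrec_decodeBits)))
    (.const none)

end

end AddBSS

namespace AddBSS

/-! ### Inputs with codes -/

/-- The tuple `(n . x . l)`, where `n` is the length of `x` and `l` consists of bits. -/
noncomputable def instanceTuple (x : Tuple) (l : List Bool) : Tuple :=
  (x.length : ℝ) :: (x ++ l.map bitReal)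

/-- The leading length tells where the input ends and the code begins. -/
theorem instanceTuple_inj {x x' : Tuple} {l l' : List Bool} :
    instanceTuple x l = instanceTuple x' l' ↔ x = x' ∧ l = l' := by
  constructor
  · intro h
    simp only [instanceTuple, List.cons.injEq, Nat.cast_inj] at h
    obtain ⟨h, h'⟩ := h
    obtain ⟨rfl, h''⟩ := List.append_inj h' h
    exact ⟨rfl, bitReal_injective.list_map h''⟩
  · rintro ⟨rfl, rfl⟩; rfl

theorem mem_haltingProblem {C : Set Machine} {z : Tuple} : z ∈ HaltingProblem C ↔
    ∃ x M, x ≠ [] ∧ M ∈ C ∧ Halts M ∅ x ∧ z = instanceTuple x (codeBits M) := Iff.rfl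

theorem instanceTuple_mem_haltingProblem {C : Set Machine} {x : Tuple} (hx : x ≠ [])
    {l : List Bool} : instanceTuple x l ∈ HaltingProblem C ↔
      ∃ M ∈ C, codeBits M = l ∧ Halts M ∅ x := by
  rw [mem_haltingProblem]
  constructor
  · rintro ⟨x', M, hx', hM, h, he⟩
    obtain ⟨rfl, rfl⟩ := instanceTuple_inj.1 he
    exact ⟨M, hM, rfl, h⟩
  · rintro ⟨M, hM, rfl, h⟩
    exact ⟨x, M, hx, hM, h, rfl⟩

theorem mem_PProblem {K : Machine} {j : ℕ} {z : Tuple} : z ∈ PProblem K j ↔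
    ∃ r, r ≠ sqrtPrime j ∧ z = instanceTuple [(j : ℝ), r] (codeBits K) := by
  simp [PProblem, instanceTuple, code_eq]

theorem instanceTuple_mem_PProblem {K : Machine} {j : ℕ} {x : Tuple} {l : List Bool} :
    instanceTuple x l ∈ PProblem K j ↔ l = codeBits K ∧ ∃ r, r ≠ sqrtPrime j ∧ x = [(j : ℝ), r] := by
  simp only [mem_PProblem, instanceTuple_inj]
  grind

theorem mem_HProblem {K : Machine} {i : ℕ} {z : Tuple} : z ∈ HProblem K i ↔
    z ∈ HEq ∨ ∃ j, (1 ≤ j ∧ j ≤ i) ∧ z ∈ PProblem K j := by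
  simp [HProblem]

theorem mem_iUnion_HProblem {K : Machine} {z : Tuple} : z ∈ ⋃ i ∈ Set.Ici 1, HProblem K i ↔
    z ∈ HEq ∨ ∃ j, 1 ≤ j ∧ z ∈ PProblem K j := by
  simp only [Set.mem_iUnion, Set.mem_Ici, mem_HProblem, exists_prop]
  constructor
  · rintro ⟨i, hi, h | ⟨j, hj, h⟩⟩
    exacts [.inl h, .inr ⟨j, hj.1, h⟩]
  · rintro (h | ⟨j, hj, h⟩)
    exacts [⟨1, le_rfl, .inl h⟩, ⟨j, hj, .inr ⟨j, ⟨hj, le_rfl⟩, h⟩⟩]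

/-- From the numbers `natCode y` for the entries of a tuple: the position where the bits begin,
and the bits. -/
def splitCodes (L : List ℕ) : Option (ℕ × List Bool) :=
  -- If the first entry is `n`, then its `natCode` is `n + 1`, exactly the number of entries before
  -- the bits. The values `1` and `2` are the codes of the reals `0` and `1`.
  if 2 ≤ L.headI ∧ L.headI ≤ L.length ∧ ∀ c ∈ L.drop L.headI, c = 1 ∨ c = 2 then
    some (L.headI, (L.drop L.headI).map fun c => decide (c = 2))
  else none

theorem natCode_bitReal (b : Bool) : natCode (bitReal b) = if b then 2 else 1 := by
  cases b
  · simpa [bitReal] using natCode_natCast 0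
  · simpa [bitReal] using natCode_natCast 1

theorem splitCodes_instanceTuple {x : Tuple} (hx : x ≠ []) (l : List Bool) :
    splitCodes ((instanceTuple x l).map natCode) = some (x.length + 1, l) := by
  have hl : 1 ≤ x.length := List.length_pos_iff.2 hx
  have e : (instanceTuple x l).map natCode =
      (x.length + 1) :: (x.map natCode ++ l.map fun b : Bool => if b then 2 else 1) := by
    simp [instanceTuple, natCode_natCast, Function.comp_def, natCode_bitReal]
  have hd : (x.map natCode ++ l.map fun b : Bool => if b then 2 else 1).drop x.length =
      l.map fun b : Bool => if b then 2 else 1 := List.drop_left' (by simp)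
  rw [e, splitCodes, if_pos]
  · simp only [List.headI_cons, List.drop_succ_cons, hd, List.map_map, Option.some.injEq,
      Prod.mk.injEq, true_and]
    convert List.map_id l using 2
    funext b
    cases b <;> simp
  · simp only [List.headI_cons, List.drop_succ_cons, hd]
    refine ⟨by omega, by simp, ?_⟩
    simp only [List.mem_map]
    rintro c ⟨b, -, rfl⟩
    cases b <;> simp

theorem splitCodes_eq_some {z : Tuple} (hz : z ≠ []) {k : ℕ} {l : List Bool}
    (h : splitCodes (z.map natCode) = some (k, l)) :
    ∃ x, x ≠ [] ∧ z = instanceTuple x l ∧ k = x.length + 1 := by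
  obtain ⟨y, z, rfl⟩ := List.exists_cons_of_ne_nil hz
  unfold splitCodes at h
  split_ifs at h with h'
  obtain ⟨h1, h2, h3⟩ := h'
  simp only [Option.some.injEq, Prod.mk.injEq, List.map_cons, List.headI_cons] at h h1 h2 h3
  obtain ⟨rfl, rfl⟩ := h
  obtain ⟨n, hn⟩ : ∃ n, natCode y = n + 1 := ⟨natCode y - 1, by omega⟩
  rw [hn] at h1 h2 h3 ⊢
  simp only [List.length_cons, List.length_map] at h2
  simp only [List.drop_succ_cons, ← List.map_drop] at h3 ⊢
  have hlen : (z.take n).length = n := by rw [List.length_take]; omega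
  refine ⟨z.take n, fun h => ?_, ?_, by rw [hlen]⟩
  · rw [h] at hlen; simp at hlen; omega
  · rw [instanceTuple, hlen, ← natCode_eq_succ.1 hn]
    congr 1
    conv_lhs => rw [← List.take_append_drop n z]
    congr 1
    rw [List.map_map, List.map_map]
    conv_lhs => rw [← List.map_id (z.drop n)]
    refine List.map_congr_left fun r hr => ?_
    rcases h3 _ (List.mem_map_of_mem hr) with h | h
    · simpa [h, bitReal] using natCode_eq_succ.1 (show natCode r = 0 + 1 from h)
    · simpa [h, bitReal] using natCode_eq_succ.1 (show natCode r = 1 + 1 from h)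

section

open Primrec

theorem primrec_splitCodes : Primrec splitCodes := by
  have hd : Primrec fun L : List ℕ => L.drop L.headI := list_drop.comp list_headI .id
  refine Primrec.ite ((nat_le.comp (.const 2) list_headI).and
    ((nat_le.comp list_headI list_length).and (PrimrecPred.comp (PrimrecPred.forall_mem_list
      ((Primrec.eq.comp .id (.const 1)).or (Primrec.eq.comp .id (.const 2)))) hd))) ?_ (.const none)
  exact option_some.comp (pair list_headI (list_map hd
    (Primrec.eq.comp .snd (.const 2)).decide.to₂))

end

/-- Reductions that transform the bits at the end of the input, depending on the length and the first
entry of the part before the bits. -/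
theorem Easier.of_transform {A B : Set Tuple} (G : ℕ × List Bool × ℕ → Option (List Bool))
    (hG : Primrec G) (hA : ∀ z ∈ A, ∃ x l, x ≠ [] ∧ z = instanceTuple x l)
    (h : ∀ x l, x ≠ [] → (instanceTuple x l ∈ A ↔
      ∃ l', G (x.length, l, natCode (x.getD 0 0)) = some l' ∧ instanceTuple x l' ∈ B)) :
    Easier A B := by
  refine Easier.of_primrec (fun L => (splitCodes L).bind fun q =>
    (G (q.1 - 1, q.2, L.getD 1 0)).map fun l => (q.1, l)) ?_ ?_ ?_
  · refine Primrec.option_bind primrec_splitCodes (Primrec.option_map (hG.comp (Primrec.pair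
      (Primrec.pred.comp (Primrec.fst.comp .snd)) (Primrec.pair (Primrec.snd.comp .snd)
      ((Primrec.list_getD 0).comp .fst (.const 1))))) (Primrec.pair
        (Primrec.fst.comp (Primrec.snd.comp .fst)) .snd).to₂).to₂
  · intro L k l hL
    simp only [Option.bind_eq_some_iff, Option.map_eq_some_iff, Prod.mk.injEq] at hL
    obtain ⟨⟨k', l'⟩, h1, l'', -, rfl, rfl⟩ := hL
    unfold splitCodes at h1
    split_ifs at h1 with h2
    simp only [Option.some.injEq, Prod.mk.injEq] at h1
    omega
  · intro z hz
    constructor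
    · intro hzA
      obtain ⟨x, l, hx, rfl⟩ := hA z hzA
      obtain ⟨l', h1, h2⟩ := (h x l hx).1 hzA
      refine ⟨x.length + 1, l', ?_, by simpa [instanceTuple] using h2⟩
      rw [splitCodes_instanceTuple hx]
      obtain ⟨y, x, rfl⟩ := List.exists_cons_of_ne_nil hx
      simpa [instanceTuple] using h1
    · rintro ⟨k, l', h1, h2⟩
      simp only [Option.bind_eq_some_iff, Option.map_eq_some_iff, Prod.mk.injEq] at h1
      obtain ⟨⟨k', l⟩, h1, l'', h3, rfl, rfl⟩ := h1
      obtain ⟨x, hx, rfl, rfl⟩ := splitCodes_eq_some hz h1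
      refine (h x l hx).2 ⟨l'', ?_, by simpa [instanceTuple] using h2⟩
      obtain ⟨y, x, rfl⟩ := List.exists_cons_of_ne_nil hx
      simpa [instanceTuple] using h3

/-! ### Reductions between the halting problems -/

theorem exists_instanceTuple_of_mem_iUnion {K : Machine} {z : Tuple}
    (h : z ∈ ⋃ i ∈ Set.Ici 1, HProblem K i) : ∃ x l, x ≠ [] ∧ z = instanceTuple x l := by
  obtain ⟨x, M, hx, -, -, rfl⟩ | ⟨j, -, h⟩ := mem_iUnion_HProblem.1 h
  · exact ⟨x, codeBits M, hx, rfl⟩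
  · obtain ⟨r, -, rfl⟩ := mem_PProblem.1 h
    exact ⟨_, _, by simp, rfl⟩

theorem not_mem_HEq {K : Machine} (hK : K ∉ EqMachines) {x : Tuple} (hx : x ≠ []) :
    instanceTuple x (codeBits K) ∉ HEq := by
  rw [HEq, instanceTuple_mem_haltingProblem hx]
  rintro ⟨M, hM, h, -⟩
  exact hK (codeBits_injective h ▸ hM)

/-- `O` exceeds `HProblem K m` only by inputs `(j, x)` of `K` with `j > m`. These are recognised
from the code and from `j`, hence rejected; every other tuple is passed to the oracle unchanged. -/
theorem easier_of_subset {K : Machine} (hK : K ∉ EqMachines) {m : ℕ} {O : Set Tuple}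
    (h₁ : HProblem K m ⊆ O) (h₂ : O ⊆ ⋃ i ∈ Set.Ici 1, HProblem K i) : Easier (HProblem K m) O := by
  -- The bounds express `1 ≤ j ≤ m`, since `natCode j = j + 1`.
  refine Easier.of_transform (fun q => if q.1 = 2 ∧ q.2.1 = codeBits K ∧ ¬ (2 ≤ q.2.2 ∧ q.2.2 ≤ m + 1)
    then none else some q.2.1) ?_ (fun z hz => exists_instanceTuple_of_mem_iUnion (h₂ (h₁ hz)))
    fun x l hx => ?_
  · exact Primrec.ite ((Primrec.eq.comp .fst (.const 2)).and ((Primrec.eq.comp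
      (Primrec.fst.comp .snd) (.const _)).and ((Primrec.nat_le.comp (.const 2)
        (Primrec.snd.comp .snd)).and (Primrec.nat_le.comp (Primrec.snd.comp .snd)
          (.const _))).not)) (.const none) (Primrec.option_some.comp (Primrec.fst.comp .snd))
  · constructor
    · intro hx'
      refine ⟨l, ?_, h₁ hx'⟩
      rw [if_neg]
      rintro ⟨h3, rfl, h4⟩
      rcases mem_HProblem.1 hx' with h5 | ⟨j, hj, h5⟩
      · exact not_mem_HEq hK hx h5
      · obtain ⟨-, r, -, rfl⟩ := instanceTuple_mem_PProblem.1 h5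
        simp only [List.getD_cons_zero, natCode_natCast] at h4
        omega
    · rintro ⟨l', h3, h4⟩
      split_ifs at h3 with h5
      simp only [Option.some.injEq] at h3
      subst h3
      refine mem_HProblem.2 ((mem_iUnion_HProblem.1 (h₂ h4)).imp_right ?_)
      rintro ⟨j, hj, h6⟩
      refine ⟨j, ?_, h6⟩
      obtain ⟨rfl, r, -, rfl⟩ := instanceTuple_mem_PProblem.1 h6
      simp only [List.length_cons, List.length_nil, zero_add, Nat.reduceAdd, true_and,
        List.getD_cons_zero, natCode_natCast] at h5
      omega

theorem instanceTuple_mem_HEq_iff {x : Tuple} (hx : x ≠ []) {l : List Bool} :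
    instanceTuple x l ∈ HEq ↔ ∃ l', transformBits l = some l' ∧ instanceTuple x l' ∈ HOrder := by
  rw [HEq, instanceTuple_mem_haltingProblem hx]
  simp only [HOrder, instanceTuple_mem_haltingProblem hx, transformBits_eq_some_iff]
  constructor
  · rintro ⟨M, hM, rfl, h⟩
    exact ⟨_, ⟨M, hM, rfl, rfl⟩, orderForm M, orderForm_mem_orderMachines hM, rfl,
      (halts_orderForm_iff hM).2 h⟩
  · rintro ⟨l', ⟨M, hM, rfl, rfl⟩, M', hM', h, h'⟩
    obtain rfl := codeBits_injective h
    exact ⟨M, hM, rfl, (halts_orderForm_iff hM).1 h'⟩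

theorem HEq_easier_HOrder : Easier HEq HOrder :=
  Easier.of_transform (fun q => transformBits q.2.1)
    (primrec_transformBits.comp (Primrec.fst.comp .snd))
    (fun _ ⟨x, M, hx, _, _, h⟩ => ⟨x, codeBits M, hx, h⟩)
    fun _ _ hx => instanceTuple_mem_HEq_iff hx

theorem SemiDecides.halts_iff {M : Machine} {O A : Set Tuple} (h : SemiDecides M O A) {x : Tuple}
    (hx : x ≠ []) : Halts M O x ↔ x ∈ A :=
  ⟨fun h' => by_contra fun hA => (h x hx).2 hA h', fun hA => ((h x hx).1 hA).halts⟩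

/-- On pairs with the code of `K` the union coincides with `HOrder`, because `K` halts exactly on
`primeRootProblem`. Elsewhere it coincides with `HEq`, and the code is transformed. -/
theorem iUnion_HProblem_easier_HOrder {K : Machine} (hK : K ∈ OrderMachines)
    (hK' : SemiDecides K ∅ primeRootProblem) (hKe : K ∉ EqMachines) :
    Easier (⋃ i ∈ Set.Ici 1, HProblem K i) HOrder := by
  refine Easier.of_transform (fun q => if q.1 = 2 ∧ q.2.1 = codeBits K then some q.2.1 else
    transformBits q.2.1) ?_ (fun z hz => exists_instanceTuple_of_mem_iUnion hz) fun x l hx => ?_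
  · exact Primrec.ite ((Primrec.eq.comp .fst (.const 2)).and (Primrec.eq.comp
      (Primrec.fst.comp .snd) (.const _))) (Primrec.option_some.comp (Primrec.fst.comp .snd))
      (primrec_transformBits.comp (Primrec.fst.comp .snd))
  · rw [mem_iUnion_HProblem]
    simp only
    split_ifs with h
    · obtain ⟨h, rfl⟩ := h
      simp only [not_mem_HEq hKe hx, false_or, Option.some.injEq, exists_eq_left', HOrder,
        instanceTuple_mem_haltingProblem hx, instanceTuple_mem_PProblem, true_and]
      constructor
      · rintro ⟨j, hj, r, hr, rfl⟩
        exact ⟨K, hK, rfl, (hK'.halts_iff hx).2 ⟨j, r, hj, hr, rfl⟩⟩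
      · rintro ⟨M, -, h', hM⟩
        obtain rfl := codeBits_injective h'
        obtain ⟨j, r, hj, hr, rfl⟩ := (hK'.halts_iff hx).1 hM
        exact ⟨j, hj, r, hr, rfl⟩
    · rw [← instanceTuple_mem_HEq_iff hx, or_iff_left]
      rintro ⟨j, -, h'⟩
      obtain ⟨rfl, r, -, rfl⟩ := instanceTuple_mem_PProblem.1 h'
      exact h ⟨rfl, rfl⟩

end AddBSS

namespace AddBSS

open Filter Topology

/-! ### Computations with affine functions of an irrational number -/

/-- The affine function with integer coefficients `v`. -/
noncomputable def aff (x : ℝ) (v : ℤ × ℤ) : ℝ := v.1 * x + v.2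

theorem aff_zero (x : ℝ) : aff x 0 = 0 := by simp [aff]

theorem aff_intCast (x : ℝ) (n : ℤ) : aff x (0, n) = n := by simp [aff]

theorem aff_natCast (x : ℝ) (n : ℕ) : aff x (0, n) = n := by simp [aff]

theorem aff_add (x : ℝ) (v w : ℤ × ℤ) : aff x (v + w) = aff x v + aff x w := by
  simp [aff]; ring

theorem aff_sub (x : ℝ) (v w : ℤ × ℤ) : aff x (v - w) = aff x v - aff x w := by
  simp [aff]; ring

theorem continuous_aff (v : ℤ × ℤ) : Continuous fun x => aff x v := by
  unfold aff; fun_prop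

/-- Linear independence of `1` and an irrational `x` over the integers. -/
theorem aff_eq_zero_iff {x : ℝ} (hx : Irrational x) {v : ℤ × ℤ} : aff x v = 0 ↔ v = 0 := by
  refine ⟨fun h => ?_, fun h => h ▸ aff_zero x⟩
  obtain ⟨a, b⟩ := v
  simp only [aff] at h
  have ha : a = 0 := by
    by_contra ha
    exact ((hx.intCast_mul ha).add_intCast b).ne_zero h
  subst ha
  simpa using h

theorem aff_injective {x : ℝ} (hx : Irrational x) : Function.Injective (aff x) := by
  intro v w h
  rw [← sub_eq_zero, ← aff_sub, aff_eq_zero_iff hx, sub_eq_zero] at h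
  exact h

/-- The configuration whose real registers contain values of affine functions. -/
noncomputable def affConfig (x : ℝ) (p : ℕ) (I : ℕ → ℕ) (v : ℕ → ℤ × ℤ) : Config :=
  ⟨p, I, fun i => aff x (v i)⟩

theorem aff_update (x : ℝ) (v : ℕ → ℤ × ℤ) (i : ℕ) (w : ℤ × ℤ) :
    (fun k => aff x (Function.update v i w k)) =
      Function.update (fun k => aff x (v k)) i (aff x w) :=
  Function.comp_update (aff x) v i w

theorem start_map_aff (x : ℝ) (vs : List (ℤ × ℤ)) : start (vs.map (aff x)) =
    affConfig x 0 (fun _ => vs.length) (fun i => vs.getD i 0) := by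
  simp only [start, affConfig, List.length_map, Config.mk.injEq, true_and]
  funext i
  rw [← aff_zero x, List.getD_map]

theorem tuple_affConfig (x : ℝ) (p : ℕ) (I : ℕ → ℕ) (v : ℕ → ℤ × ℤ) :
    (affConfig x p I v).tuple = ((List.range (I 0)).map v).map (aff x) := by
  simp [Config.tuple, affConfig]

/-- Instructions other than jumps act on the coefficients. -/
theorem exists_exec_affConfig (c : Instr) (p : ℕ) (I : ℕ → ℕ) (v : ℕ → ℤ × ℤ) :
    (∃ p' I' v', ∀ O x, c.exec O (affConfig x p I v) = affConfig x p' I' v') ∨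
      (∃ j l₁ l₂, c = .ifZero j l₁ l₂) ∨ c.IsOrderTest ∨ c.IsQuery := by
  cases c with
  | add i j k => exact .inl ⟨p + 1, I, Function.update v i (v j + v k), fun O x => by
      simp [Instr.exec, affConfig, aff_update, aff_add]⟩
  | sub i j k => exact .inl ⟨p + 1, I, Function.update v i (v j - v k), fun O x => by
      simp [Instr.exec, affConfig, aff_update, aff_sub]⟩
  | setZero j => exact .inl ⟨p + 1, I, Function.update v j 0, fun O x => by
      simp [Instr.exec, affConfig, aff_update, aff_zero]⟩
  | setOne j => exact .inl ⟨p + 1, I, Function.update v j (0, 1), fun O x => by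
      simp [Instr.exec, affConfig, aff_update, aff_intCast]⟩
  | ifZero j l₁ l₂ => exact .inr (.inl ⟨j, l₁, l₂, rfl⟩)
  | ifNonneg j l₁ l₂ => exact .inr (.inr (.inl trivial))
  | copy j k => exact .inl ⟨p + 1, I, Function.update v (I j - 1) (v (I k - 1)), fun O x => by
      simp [Instr.exec, affConfig, aff_update]⟩
  | idxOne j => exact .inl ⟨p + 1, Function.update I j 1, v, fun O x => rfl⟩
  | idxSucc j => exact .inl ⟨p + 1, Function.update I j (I j + 1), v, fun O x => rfl⟩
  | ifIdxEq j k l₁ l₂ => exact .inl ⟨if I j = I k then l₁ else l₂, I, v, fun O x => rfl⟩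
  | query l₁ l₂ => exact .inr (.inr (.inr trivial))

theorem exec_ifZero_affConfig {x : ℝ} (hx : Irrational x) (O : Set Tuple) (j l₁ l₂ p : ℕ)
    (I : ℕ → ℕ) (v : ℕ → ℤ × ℤ) : (Instr.ifZero j l₁ l₂).exec O (affConfig x p I v) =
      affConfig x (if v j = 0 then l₁ else l₂) I v := by
  simp only [Instr.exec, affConfig, aff_eq_zero_iff hx]

/-- Machines with equality tests work in the same way for all irrational numbers. -/
theorem exists_iterate_affConfig {M : Machine} (hM : M ∈ EqMachines) (O : Set Tuple) (p : ℕ)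
    (I : ℕ → ℕ) (v : ℕ → ℤ × ℤ) (t : ℕ) : ∃ p' I' v', ∀ x, Irrational x →
      (step M O)^[t] (affConfig x p I v) = affConfig x p' I' v' := by
  induction t with
  | zero => exact ⟨p, I, v, fun _ _ => rfl⟩
  | succ t ih =>
    obtain ⟨p₁, I₁, v₁, h⟩ := ih
    simp only [Function.iterate_succ_apply']
    rcases hc : M[p₁]? with _ | c
    · refine ⟨p₁, I₁, v₁, fun x hx => ?_⟩
      rw [h x hx, step_of_le (List.getElem?_eq_none_iff.1 hc)]
    · rcases exists_exec_affConfig c p₁ I₁ v₁ with ⟨p₂, I₂, v₂, h₂⟩ | ⟨j, l₁, l₂, rfl⟩ | h' | h'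
      · refine ⟨p₂, I₂, v₂, fun x hx => ?_⟩
        rw [h x hx, step_of_getElem? (c := affConfig x p₁ I₁ v₁) hc, h₂]
      · refine ⟨if v₁ j = 0 then l₁ else l₂, I₁, v₁, fun x hx => ?_⟩
        rw [h x hx, step_of_getElem? (c := affConfig x p₁ I₁ v₁) hc, exec_ifZero_affConfig hx]
      · exact absurd h' (hM c (List.mem_of_getElem? hc)).1
      · exact absurd h' (hM c (List.mem_of_getElem? hc)).2

/-- All irrational numbers lead to the same labels, index contents and coefficients after `t` steps,
so the stopping time is also the same. -/
theorem Halts.of_irrational {M : Machine} (hM : M ∈ EqMachines) {O : Set Tuple}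
    {vs : List (ℤ × ℤ)} {x x' : ℝ} (hx : Irrational x) (hx' : Irrational x')
    (h : Halts M O (vs.map (aff x))) : Halts M O (vs.map (aff x')) := by
  obtain ⟨t, ht⟩ := h
  refine ⟨t, ?_⟩
  rw [run, start_map_aff] at ht ⊢
  obtain ⟨p, I, v, h⟩ := exists_iterate_affConfig hM O 0 (fun _ => vs.length)
    (fun i => vs.getD i 0) t
  rw [h x hx] at ht
  rw [h x' hx']
  exact ht

/-- The coefficients of a bit. -/
def bitAff (b : Bool) : ℤ × ℤ := (0, if b then 1 else 0)

theorem map_aff_bitAff (x : ℝ) (l : List Bool) : (l.map bitAff).map (aff x) = l.map bitReal := by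
  rw [List.map_map]
  refine List.map_congr_left fun b _ => ?_
  cases b <;> simp [bitAff, bitReal, aff]

/-- An integer value forces slope zero when `x` is irrational. The length and the code are therefore
visible in the coefficients, independently of `x`. -/
theorem map_aff_eq_instanceTuple_iff {x : ℝ} (hx : Irrational x) {vs : List (ℤ × ℤ)} {y : Tuple}
    {l : List Bool} : vs.map (aff x) = instanceTuple y l ↔
      ∃ ws : List (ℤ × ℤ), ws.map (aff x) = y ∧ vs = (0, (ws.length : ℤ)) :: (ws ++ l.map bitAff) := by
  constructor
  · intro h
    rw [instanceTuple, List.map_eq_cons_iff] at h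
    obtain ⟨v, vs, rfl, hv, h⟩ := h
    obtain ⟨ws, us, rfl, rfl, h'⟩ := List.map_eq_append_iff.1 h
    rw [← map_aff_bitAff x] at h'
    obtain rfl := (aff_injective hx).list_map h'
    rw [List.length_map, ← aff_natCast x] at hv
    exact ⟨ws, rfl, by rw [aff_injective hx hv]⟩
  · rintro ⟨ws, rfl, rfl⟩
    simp only [instanceTuple, List.map_cons, List.map_append, map_aff_bitAff, aff_natCast,
      List.length_map]

theorem mem_HEq_of_irrational {vs : List (ℤ × ℤ)} {x x' : ℝ} (hx : Irrational x)
    (hx' : Irrational x') (h : vs.map (aff x) ∈ HEq) : vs.map (aff x') ∈ HEq := by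
  obtain ⟨y, M, hy, hM, hh, he⟩ := mem_haltingProblem.1 h
  obtain ⟨ws, rfl, rfl⟩ := (map_aff_eq_instanceTuple_iff hx).1 he
  rw [(map_aff_eq_instanceTuple_iff hx').2 ⟨ws, rfl, rfl⟩]
  refine ⟨_, M, ?_, hM, hh.of_irrational hM hx hx', rfl⟩
  simpa using hy

theorem map_aff_mem_PProblem_iff {K : Machine} {j : ℕ} {vs : List (ℤ × ℤ)} {x : ℝ}
    (hx : Irrational x) : vs.map (aff x) ∈ PProblem K j ↔
      ∃ w, vs = (0, 2) :: ([(0, (j : ℤ)), w] ++ (codeBits K).map bitAff) ∧ aff x w ≠ sqrtPrime j := by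
  rw [mem_PProblem]
  constructor
  · rintro ⟨r, hr, h⟩
    obtain ⟨ws, h1, rfl⟩ := (map_aff_eq_instanceTuple_iff hx).1 h
    rw [List.map_eq_cons_iff] at h1
    obtain ⟨v, ws, rfl, hv, h1⟩ := h1
    rw [List.map_eq_cons_iff] at h1
    obtain ⟨w, ws, rfl, rfl, h1⟩ := h1
    rw [List.map_eq_nil_iff] at h1
    subst h1
    rw [← aff_natCast x] at hv
    exact ⟨w, by rw [aff_injective hx hv]; rfl, hr⟩
  · rintro ⟨w, rfl, hw⟩
    exact ⟨_, hw, (map_aff_eq_instanceTuple_iff hx).2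
      ⟨[(0, (j : ℤ)), w], by simp [aff_natCast], rfl⟩⟩

/-! ### Perturbation of irrational inputs -/

/-- If the answers of the oracle do not change under small perturbations of `x₀`, then the steps of
a computation do not change either. -/
theorem exists_iterate_affConfig_eventually (M : Machine) {O : Set Tuple} {x₀ : ℝ} {l : Filter ℝ}
    (hx₀ : Irrational x₀) (hl : l ≤ 𝓝 x₀) (hirr : ∀ᶠ x in l, Irrational x)
    (hO : ∀ vs : List (ℤ × ℤ), ∀ᶠ x in l, (vs.map (aff x) ∈ O ↔ vs.map (aff x₀) ∈ O))
    (p : ℕ) (I : ℕ → ℕ) (v : ℕ → ℤ × ℤ) (t : ℕ) : ∃ p' I' v',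
      (step M O)^[t] (affConfig x₀ p I v) = affConfig x₀ p' I' v' ∧
        ∀ᶠ x in l, (step M O)^[t] (affConfig x p I v) = affConfig x p' I' v' := by
  induction t with
  | zero => exact ⟨p, I, v, rfl, .of_forall fun _ => rfl⟩
  | succ t ih =>
    obtain ⟨p₁, I₁, v₁, h₀, h⟩ := ih
    simp only [Function.iterate_succ_apply']
    rcases hc : M[p₁]? with _ | c
    · refine ⟨p₁, I₁, v₁, ?_, h.mono fun x hx => ?_⟩
      · rw [h₀, step_of_le (List.getElem?_eq_none_iff.1 hc)]
      · rw [hx, step_of_le (List.getElem?_eq_none_iff.1 hc)]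
    have hs (x : ℝ) : step M O (affConfig x p₁ I₁ v₁) = c.exec O (affConfig x p₁ I₁ v₁) :=
      step_of_getElem? (c := affConfig x p₁ I₁ v₁) hc
    rcases exists_exec_affConfig c p₁ I₁ v₁ with ⟨p₂, I₂, v₂, h₂⟩ | ⟨j, l₁, l₂, rfl⟩ | h' | h'
    · exact ⟨p₂, I₂, v₂, by rw [h₀, hs, h₂], h.mono fun x hx => by rw [hx, hs, h₂]⟩
    · refine ⟨_, I₁, v₁, by rw [h₀, hs, exec_ifZero_affConfig hx₀], ?_⟩
      filter_upwards [h, hirr] with x hx hxi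
      rw [hx, hs, exec_ifZero_affConfig hxi]
    · cases c <;> simp only [Instr.IsOrderTest] at h'
      rename_i j l₁ l₂
      refine ⟨_, I₁, v₁, by rw [h₀, hs]; rfl, ?_⟩
      -- A strict sign persists by continuity; the value zero at the irrational `x₀` means that the
      -- function is identically zero.
      have hsign : ∀ᶠ x in l, (0 ≤ aff x (v₁ j) ↔ 0 ≤ aff x₀ (v₁ j)) := by
        have hc := ((continuous_aff (v₁ j)).tendsto x₀).mono_left hl
        rcases lt_trichotomy (aff x₀ (v₁ j)) 0 with h0 | h0 | h0
        · filter_upwards [hc.eventually_lt_const h0] with x hx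
          simp [not_le.2 hx, not_le.2 h0]
        · rw [aff_eq_zero_iff hx₀] at h0
          simp [h0, aff_zero]
        · filter_upwards [hc.eventually_const_lt h0] with x hx
          simp [hx.le, h0.le]
      filter_upwards [h, hsign] with x hx hx'
      rw [hx, hs]
      exact congrArg (fun q => Config.mk q I₁ fun i => aff x (v₁ i)) (if_congr hx' rfl rfl)
    · cases c <;> simp only [Instr.IsQuery] at h'
      rename_i l₁ l₂
      refine ⟨_, I₁, v₁, by rw [h₀, hs]; rfl, ?_⟩
      filter_upwards [h, hO ((List.range (I₁ 0)).map v₁)] with x hx hx'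
      rw [hx, hs]
      rw [← tuple_affConfig x p₁, ← tuple_affConfig x₀ p₁] at hx'
      classical
      exact congrArg (fun q => Config.mk q I₁ fun i => aff x (v₁ i)) (if_congr hx' rfl rfl)

/-! ### Square roots of distinct primes and the lower bound -/

theorem prime_nth_sub_one (j : ℕ) : (Nat.nth Nat.Prime (j - 1)).Prime := Nat.prime_nth_prime _

theorem irrational_sqrtPrime (j : ℕ) : Irrational (sqrtPrime j) :=
  (prime_nth_sub_one j).irrational_sqrt

theorem sqrtPrime_sq (j : ℕ) : sqrtPrime j * sqrtPrime j = Nat.nth Nat.Prime (j - 1) :=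
  Real.mul_self_sqrt (Nat.cast_nonneg _)

theorem nth_prime_sub_one_injective {i j : ℕ} (hi : 1 ≤ i) (hj : 1 ≤ j)
    (h : Nat.nth Nat.Prime (i - 1) = Nat.nth Nat.Prime (j - 1)) : i = j := by
  have := Nat.nth_injective Nat.infinite_setOfPred_prime h
  omega

theorem aff_sqrtPrime_ne {i j : ℕ} (hi : 1 ≤ i) (hj : 1 ≤ j) (hij : i ≠ j) (w : ℤ × ℤ) :
    aff (sqrtPrime i) w ≠ sqrtPrime j := by
  obtain ⟨a, b⟩ := w
  intro h
  have hp := prime_nth_sub_one i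
  have hq := prime_nth_sub_one j
  have hpq : Nat.nth Nat.Prime (i - 1) ≠ Nat.nth Nat.Prime (j - 1) :=
    fun h => hij (nth_prime_sub_one_injective hi hj h)
  have hi2 := sqrtPrime_sq i
  have hj2 := sqrtPrime_sq j
  have hirr := irrational_sqrtPrime i
  generalize Nat.nth Nat.Prime (i - 1) = p at *
  generalize Nat.nth Nat.Prime (j - 1) = q at *
  -- Squaring `a * √p + b = √q` gives an affine relation for `√p`, so `a * b = 0`. Then either `√q`
  -- is an integer or `p` divides `q`.
  have h' : aff (sqrtPrime i) (2 * a * b, a * a * p + b * b - q) = 0 := by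
    rw [← h] at hj2
    simp only [aff] at hj2 ⊢
    push_cast
    linear_combination hj2 - a * a * hi2
  rw [aff_eq_zero_iff hirr, Prod.mk_eq_zero] at h'
  obtain ⟨h1, h2⟩ := h'
  rcases mul_eq_zero.1 h1 with h1 | rfl
  · obtain rfl : a = 0 := by omega
    refine irrational_sqrtPrime j ⟨b, ?_⟩
    rw [← h]
    simp [aff]
  · have h3 : a * a * (p : ℤ) = q := by linarith
    have h4 : (p : ℤ) ∣ q := ⟨a * a, by rw [← h3]; ring⟩
    exact hpq ((Nat.prime_dvd_prime_iff_eq hp hq).1 (Int.natCast_dvd_natCast.1 h4))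

/-- A problem that contains, for inputs `(k + 1, x)` of the machine `K`, exactly those with
`x ≠ √p_(k+1)` is not easier than `HProblem K k`. -/
theorem not_easier_HProblem {K : Machine} {k : ℕ} {B : Set Tuple}
    (hB : ∀ x, instanceTuple [((k + 1 : ℕ) : ℝ), x] (codeBits K) ∈ B ↔ x ≠ sqrtPrime (k + 1)) :
    ¬ Easier B (HProblem K k) := by
  rintro ⟨M, -, hM⟩
  set x₀ := sqrtPrime (k + 1) with hx₀
  have hirr₀ : Irrational x₀ := irrational_sqrtPrime _
  -- Rational shifts give irrational points that tend to `x₀` without meeting it.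
  let u : ℕ → ℝ := fun n => x₀ + ((1 / (n + 1 : ℚ) : ℚ) : ℝ)
  have hu (n : ℕ) : Irrational (u n) ∧ u n ≠ x₀ := by
    refine ⟨hirr₀.add_ratCast _, ?_⟩
    have : (0 : ℝ) < ((1 / (n + 1 : ℚ) : ℚ) : ℝ) := by exact_mod_cast Nat.one_div_pos_of_nat
    simp only [u, ne_eq, add_eq_left]
    exact this.ne'
  have hlim : Tendsto u atTop (𝓝 x₀) := by
    have := (tendsto_one_div_add_atTop_nhds_zero_nat (𝕜 := ℝ)).const_add x₀
    simpa [u] using this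
  let l : Filter ℝ := map u atTop
  have hirr : ∀ᶠ x in l, Irrational x := eventually_map.2 (.of_forall fun n => (hu n).1)
  have hne : ∀ᶠ x in l, x ≠ x₀ := eventually_map.2 (.of_forall fun n => (hu n).2)
  have hO (vs : List (ℤ × ℤ)) : ∀ᶠ x in l,
      (vs.map (aff x) ∈ HProblem K k ↔ vs.map (aff x₀) ∈ HProblem K k) := by
    have h1 : ∀ᶠ x in l, ∀ j ∈ Set.Icc 1 k,
        (vs.map (aff x) ∈ PProblem K j ↔ vs.map (aff x₀) ∈ PProblem K j) := by
      -- Finiteness of the level is essential: finitely many excluded values `√p_j` can be avoided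
      -- simultaneously near `x₀`.
      refine (Set.finite_Icc 1 k).eventually_all.2 fun j hj => ?_
      have h2 (w : ℤ × ℤ) : ∀ᶠ x in l, aff x w ≠ sqrtPrime j :=
        (((continuous_aff w).tendsto x₀).mono_left hlim).eventually_ne
          (aff_sqrtPrime_ne (by omega) hj.1 (by have := hj.2; omega) w)
      by_cases hvs : ∃ w, vs = (0, 2) :: ([(0, (j : ℤ)), w] ++ (codeBits K).map bitAff)
      · obtain ⟨w, hw⟩ := hvs
        filter_upwards [hirr, h2 w] with x hx hxw
        rw [map_aff_mem_PProblem_iff hx, map_aff_mem_PProblem_iff hirr₀]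
        exact iff_of_true ⟨w, hw, hxw⟩
          ⟨w, hw, aff_sqrtPrime_ne (by omega) hj.1 (by have := hj.2; omega) w⟩
      · filter_upwards [hirr] with x hx
        rw [map_aff_mem_PProblem_iff hx, map_aff_mem_PProblem_iff hirr₀]
        exact iff_of_false (fun ⟨w, hw, _⟩ => hvs ⟨w, hw⟩) fun ⟨w, hw, _⟩ => hvs ⟨w, hw⟩
    filter_upwards [hirr, h1] with x hx hx'
    rw [mem_HProblem, mem_HProblem]
    refine or_congr ⟨mem_HEq_of_irrational hx hirr₀, mem_HEq_of_irrational hirr₀ hx⟩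
      (exists_congr fun j => and_congr_right fun hj => hx' j hj)
  let vs : List (ℤ × ℤ) := (0, 2) :: ([(0, ((k + 1 : ℕ) : ℤ)), (1, 0)] ++ (codeBits K).map bitAff)
  have hvs (x : ℝ) : vs.map (aff x) = instanceTuple [((k + 1 : ℕ) : ℝ), x] (codeBits K) := by
    simp only [vs, List.map_cons, List.map_append, map_aff_bitAff, aff_natCast, instanceTuple,
      List.map_nil]
    simp [aff]
  have h₀ := (hM (vs.map (aff x₀)) (by simp [vs])).2 (by rw [hvs, hB]; simp)
  obtain ⟨t, ht, hy⟩ := h₀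
  rw [run, start_map_aff] at ht hy
  obtain ⟨p, I, v, hp₀, hp⟩ := exists_iterate_affConfig_eventually M hirr₀ hlim hirr hO 0
    (fun _ => vs.length) (fun i => vs.getD i 0) t
  rw [hp₀, tuple_affConfig, show [(0 : ℝ)] = [0].map (aff x₀) by simp [aff_zero]] at hy
  have hy' := (aff_injective hirr₀).list_map hy
  rw [hp₀] at ht
  -- At this nearby point `x ≠ x₀` the computation repeats the one at `x₀` and outputs `0`, although
  -- the correct answer is `1`.
  obtain ⟨x, hx, hxp⟩ := (hne.and hp).exists
  have h1 := (hM (vs.map (aff x)) (by simp [vs])).1 (by rwa [hvs, hB])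
  have h2 : HaltsWith M (HProblem K k) (vs.map (aff x)) [0] := by
    refine ⟨t, ?_⟩
    rw [run, start_map_aff, hxp, tuple_affConfig, hy']
    exact ⟨ht, by simp [aff_zero]⟩
  simpa using h1.unique h2

/-- A machine with equality tests treats `(1, √2)` and `(1, √3)` alike, but `K` has to halt only on
the second. -/
theorem not_mem_eqMachines {K : Machine} (hK : SemiDecides K ∅ primeRootProblem) :
    K ∉ EqMachines := by
  intro hE
  have h (x : ℝ) : [(0, (1 : ℤ)), (1, 0)].map (aff x) = [(1 : ℝ), x] := by simp [aff]
  have hne : sqrtPrime 2 ≠ sqrtPrime 1 := by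
    have := aff_sqrtPrime_ne (i := 2) (j := 1) (by omega) le_rfl (by omega) (1, 0)
    simpa [aff] using this
  have h2 : Halts K ∅ [(1 : ℝ), sqrtPrime 2] :=
    (hK.halts_iff (by simp)).2 ⟨1, _, le_rfl, hne, by simp⟩
  rw [← h _] at h2
  have h1 := h2.of_irrational hE (irrational_sqrtPrime 2) (irrational_sqrtPrime 1)
  rw [h _, hK.halts_iff (by simp)] at h1
  obtain ⟨j, r, hj, hr, he⟩ := h1
  simp only [List.cons.injEq, and_true] at he
  obtain ⟨he, rfl⟩ := he
  obtain rfl : j = 1 := by exact_mod_cast he.symm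
  exact hr rfl

end AddBSS

namespace AddBSS

open Encodable

/-! ### A machine that semi-decides the problem of the square roots of prime numbers -/

theorem primrecPred_nat_prime : PrimrecPred Nat.Prime := by
  have hdvd : PrimrecRel fun m p : ℕ => m ∣ p → m = 1 := by
    have h1 : PrimrecRel fun m p : ℕ => p % m = 0 :=
      Primrec.eq.comp (Primrec.nat_mod.comp .snd .fst) (.const 0)
    have h2 : PrimrecRel fun m _ : ℕ => m = 1 := Primrec.eq.comp .fst (.const 1)
    exact (h1.not.or h2).of_eq fun q => by
      simp only [← Nat.dvd_iff_mod_eq_zero, imp_iff_not_or]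
  refine ((Primrec.nat_le.comp (.const 2) .id).and (hdvd.forall_lt.comp .id .id)).of_eq fun p => ?_
  exact Nat.prime_def_lt.symm

theorem primrec_count_prime : Primrec (Nat.count Nat.Prime) := by
  refine (Primrec.nat_rec₁ (f := fun n c => c + if n.Prime then 1 else 0) 0
    (Primrec.nat_add.comp .snd (Primrec.ite (primrecPred_nat_prime.comp .fst) (.const 1)
      (.const 0)))).of_eq fun n => ?_
  induction n with
  | zero => rfl
  | succ n ih => rw [Nat.count_succ, ← ih]

/-- The number `s` codes a prime number `p` and a rational number `a / b`. If `p` is the prime number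
with the index that is given by the list `L` of the numbers `natCode y` for the entries of the input,
then the result is `a`, `b`, and whether `a / b < √p` or `a / b > √p`. Otherwise, and if `b = 0`,
the result means that nothing is found. -/
def search (L : List ℕ) (s : ℕ) : Bool × ℕ × ℕ :=
  -- For `p = p_j` there are `j - 1` smaller primes, while the first entry `j` has `natCode` equal
  -- to `j + 1`; hence the summand `2`.
  if (L.length = 2 ∧ s.unpair.1.Prime ∧ Nat.count Nat.Prime s.unpair.1 + 2 = L.headI) ∧
    s.unpair.2.unpair.1 * s.unpair.2.unpair.1 ≠
      s.unpair.1 * (s.unpair.2.unpair.2 * s.unpair.2.unpair.2) then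
    (decide (s.unpair.2.unpair.1 * s.unpair.2.unpair.1 <
      s.unpair.1 * (s.unpair.2.unpair.2 * s.unpair.2.unpair.2)), s.unpair.2.unpair)
  else (true, 0, 0)

theorem primrec_search : Primrec₂ search := by
  have hs : Primrec fun q : List ℕ × ℕ => q.2.unpair := Primrec.unpair.comp .snd
  have hp := Primrec.fst.comp hs
  have hab : Primrec fun q : List ℕ × ℕ => q.2.unpair.2.unpair :=
    Primrec.unpair.comp (Primrec.snd.comp hs)
  have ha := Primrec.fst.comp hab
  have hb := Primrec.snd.comp hab
  have haa := Primrec.nat_mul.comp ha ha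
  have hpbb := Primrec.nat_mul.comp hp (Primrec.nat_mul.comp hb hb)
  exact Primrec.ite (((Primrec.eq.comp (Primrec.list_length.comp .fst) (.const 2)).and
    ((primrecPred_nat_prime.comp hp).and (Primrec.eq.comp (Primrec.nat_add.comp
      (primrec_count_prime.comp hp) (.const 2)) (Primrec.list_headI.comp .fst)))).and
        (Primrec.eq.comp haa hpbb).not)
    (Primrec.pair (Primrec.nat_lt.comp haa hpbb).decide hab) (.const _)

/-- The search for a rational number between `x` and the square root of a prime number is
successful. -/
def Found (L : List ℕ) (x : ℝ) (s : ℕ) : Prop :=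
  -- For `b > 0` this is `x < a / b` or `x > a / b`, on the side of `a / b` away from `√p`. The
  -- default `(true, 0, 0)` gives the false statement `0 < 0`.
  (if (search L s).1 then 1 else -1) * ((search L s).2.2 * x - (search L s).2.1) < 0

theorem mul_lt_of_sq_lt {a b p : ℕ} (h : a * a < p * (b * b)) : (a : ℝ) < b * √p := by
  have h' : (a : ℝ) * a < p * (b * b) := by exact_mod_cast h
  refine lt_of_mul_self_lt_mul_self₀ (by positivity) ?_
  rw [mul_mul_mul_comm, Real.mul_self_sqrt (Nat.cast_nonneg p)]
  linarith

theorem lt_mul_of_lt_sq {a b p : ℕ} (h : p * (b * b) < a * a) : b * √p < (a : ℝ) := by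
  have h' : (p : ℝ) * (b * b) < a * a := by exact_mod_cast h
  refine lt_of_mul_self_lt_mul_self₀ (by positivity) ?_
  rw [mul_mul_mul_comm, Real.mul_self_sqrt (Nat.cast_nonneg p)]
  linarith

/-- Density of the rationals. For tuples of other lengths `x` is arbitrary, because the search
rejects them anyway. -/
theorem exists_found_iff {z : Tuple} {x : ℝ} (hx : z.length = 2 → x = z.getD 1 0) :
    (∃ s, Found (z.map natCode) x s) ↔ z ∈ primeRootProblem := by
  constructor
  · rintro ⟨s, hs⟩
    unfold Found search at hs
    split_ifs at hs with h1 h2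
    · obtain ⟨⟨h3, hp, h4⟩, h5⟩ := h1
      rw [List.length_map] at h3
      obtain ⟨y, x', rfl⟩ := List.length_eq_two.1 h3
      obtain rfl : x = x' := hx h3
      generalize s.unpair.1 = p at *
      generalize s.unpair.2.unpair.1 = a at *
      generalize s.unpair.2.unpair.2 = b at *
      simp only [List.map_cons, List.headI_cons] at h4
      refine ⟨Nat.count Nat.Prime p + 1, x, by omega, ?_, ?_⟩
      · rintro rfl
        simp only [sqrtPrime, Nat.add_sub_cancel, Nat.nth_count hp] at hs
        have := mul_lt_of_sq_lt (of_decide_eq_true h2)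
        linarith
      · rw [natCode_eq_succ.1 h4.symm]
    · obtain ⟨⟨h3, hp, h4⟩, h5⟩ := h1
      rw [List.length_map] at h3
      obtain ⟨y, x', rfl⟩ := List.length_eq_two.1 h3
      obtain rfl : x = x' := hx h3
      generalize s.unpair.1 = p at *
      generalize s.unpair.2.unpair.1 = a at *
      generalize s.unpair.2.unpair.2 = b at *
      simp only [List.map_cons, List.headI_cons] at h4
      refine ⟨Nat.count Nat.Prime p + 1, x, by omega, ?_, ?_⟩
      · rintro rfl
        simp only [sqrtPrime, Nat.add_sub_cancel, Nat.nth_count hp] at hs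
        have := lt_mul_of_lt_sq (lt_of_le_of_ne (not_lt.1 (by simpa using h2)) h5.symm)
        linarith
      · rw [natCode_eq_succ.1 h4.symm]
    · simp at hs
    · simp at hs
  · rintro ⟨j, x', hj, hne, rfl⟩
    obtain rfl : x = x' := hx rfl
    have hp := prime_nth_sub_one j
    have hcount : Nat.count Nat.Prime (Nat.nth Nat.Prime (j - 1)) = j - 1 :=
      Nat.count_nth_of_infinite Nat.infinite_setOfPred_prime _
    unfold sqrtPrime at hne
    generalize Nat.nth Nat.Prime (j - 1) = p at *
    have key (a b : ℕ) (hab : a * a ≠ p * (b * b)) : search ([(j : ℝ), x].map natCode)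
        (Nat.pair p (Nat.pair a b)) = (decide (a * a < p * (b * b)), a, b) := by
      have hj' : j - 1 + 2 = j + 1 := by omega
      simp [search, hp, hcount, hab, natCode_natCast, hj']
    have hsq : √(p : ℝ) * √p = p := Real.mul_self_sqrt (Nat.cast_nonneg p)
    have of_nonneg (q : ℚ) (hq : (0 : ℝ) ≤ q) : ∃ a b : ℕ, 0 < b ∧ (a : ℝ) = q * b := by
      have hq' : 0 ≤ q := by exact_mod_cast hq
      refine ⟨q.num.toNat, q.den, q.den_pos, ?_⟩
      have h1 : ((q.num.toNat : ℤ) : ℚ) = q * q.den := by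
        rw [Int.toNat_of_nonneg (Rat.num_nonneg.2 hq'), Rat.mul_den_eq_num]
      exact_mod_cast h1
    rcases lt_or_gt_of_ne hne with hlt | hlt
    -- The maximum with `0` makes `q` positive, so that its numerator is a natural number even for
    -- negative `x`.
    · obtain ⟨q, hq1, hq2⟩ := exists_rat_btwn (max_lt hlt (Real.sqrt_pos.2 (Nat.cast_pos.2 hp.pos)))
      obtain ⟨hxq, h0q⟩ := max_lt_iff.1 hq1
      obtain ⟨a, b, hb, hab⟩ := of_nonneg q h0q.le
      have hb' : (0 : ℝ) < b := by exact_mod_cast hb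
      have h : a * a < p * (b * b) := by
        have : (a : ℝ) * a < p * (b * b) := by
          rw [hab, mul_mul_mul_comm, ← hsq]
          exact mul_lt_mul_of_pos_right (mul_self_lt_mul_self h0q.le hq2) (mul_pos hb' hb')
        exact_mod_cast this
      refine ⟨Nat.pair p (Nat.pair a b), ?_⟩
      have := mul_lt_mul_of_pos_right hxq hb'
      simp only [Found, key a b h.ne, h, decide_true, if_true, one_mul, hab]
      linarith
    · obtain ⟨q, hq1, hq2⟩ := exists_rat_btwn hlt
      have h0q : (0 : ℝ) ≤ q := (Real.sqrt_nonneg _).trans hq1.le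
      obtain ⟨a, b, hb, hab⟩ := of_nonneg q h0q
      have hb' : (0 : ℝ) < b := by exact_mod_cast hb
      have h : p * (b * b) < a * a := by
        have : (p : ℝ) * (b * b) < a * a := by
          rw [hab, mul_mul_mul_comm, ← hsq]
          exact mul_lt_mul_of_pos_right (mul_self_lt_mul_self (Real.sqrt_nonneg _) hq1)
            (mul_pos hb' hb')
        exact_mod_cast this
      refine ⟨Nat.pair p (Nat.pair a b), ?_⟩
      have := mul_lt_mul_of_pos_right hq2 hb'
      simp only [Found, key a b h.ne', h.not_gt, decide_false, Bool.false_eq_true, if_false, hab]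
      linarith

namespace Prog

/-- The instruction `o` is executed as often as the difference of `I_r` and `I_c` indicates. -/
theorem ensures_repeat {O : Set Tuple} {o : Op} {c r m : ℕ} {d y : ℝ} {k : ℕ} (hk : k ≠ 0)
    (hcr : c ≠ r) (ho : ∀ s : Mem, s.Z k = y → o.exec s = ⟨s.I, Function.update s.Z 0 (s.Z 0 + d)⟩)
    {s : Mem} (hy : s.Z k = y) (hc : s.I c = 1) (hr : s.I r = m + 1) :
    (loop (.idxNe c r) (seq (op o) (op (.idxSucc c)))).Ensures O (fun s' =>
      (∀ i, i ≠ c → s'.I i = s.I i) ∧ s'.Z = Function.update s.Z 0 (s.Z 0 + m * d)) s := by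
  refine (ensures_loop (fun n s' => (∀ i, i ≠ c → s'.I i = s.I i) ∧ ∃ i : ℕ, i + n = m ∧
    s'.I c = i + 1 ∧ s'.Z = Function.update s.Z 0 (s.Z 0 + i * d)) ?_ ?_ (n := m) ?_).mono ?_
  · rintro s' ⟨h1, i, rfl, h2, -⟩
    simp [Test.Holds, h2, h1 r hcr.symm, hr]
  · rintro n s' ⟨h1, i, hi, h2, h3⟩
    simp only [ensures_seq_eq, ensures_op_eq]
    rw [ho s' (by rw [h3, Function.update_of_ne hk, hy])]
    refine ⟨?_, fun i hi => ?_, i + 1, by omega, ?_, ?_⟩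
    · simp only [Test.Holds, h2, h1 r hcr.symm, hr]; omega
    · simp [Op.exec, hi, h1 i hi]
    · simp [Op.exec, h2]
    · simp only [Op.exec, h3, Function.update_idem, Function.update_self]
      congr 1
      push_cast
      ring
  · exact ⟨fun _ _ => rfl, 0, by simp, by simpa using hc, by simp⟩
  · rintro s' ⟨h1, i, rfl, -, h3⟩
    exact ⟨h1, h3⟩

/-- One round of the search. -/
theorem exists_searchStep : ∃ p : Prog, p.NoQuery ∧ ∀ (O : Set Tuple) (L : List ℕ) (x : ℝ) (n : ℕ)
    (s : Mem), s.I 4 = 1 → s.I 6 = encode L + 1 → s.I 7 = 1 → s.I 8 = n + 1 → s.Z 6 = x →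
      p.Ensures O (fun s' => s'.I 4 = 1 ∧ s'.I 6 = encode L + 1 ∧
        ((Found L x n → s'.I 7 = 2) ∧ (¬ Found L x n → s'.I 7 = 1)) ∧ s'.I 8 = n + 2 ∧
          s'.Z 6 = x) s := by
  obtain ⟨p₁, hp₁, hps₁⟩ := exists_program₂ (f := fun L n => (search L n).1)
    (Primrec.fst.comp primrec_search) 13 6 8 9 (by omega) (by omega) (by omega)
  obtain ⟨p₂, hp₂, hps₂⟩ := exists_program₂ (f := fun L n => (search L n).2.1)
    (Primrec.fst.comp (Primrec.snd.comp primrec_search)) 13 6 8 10 (by omega) (by omega) (by omega)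
  obtain ⟨p₃, hp₃, hps₃⟩ := exists_program₂ (f := fun L n => (search L n).2.2)
    (Primrec.snd.comp (Primrec.snd.comp primrec_search)) 13 6 8 11 (by omega) (by omega) (by omega)
  refine ⟨seq p₁ <| seq p₂ <| seq p₃ <| seq (op (.setZero 0)) <| seq (op (.setOne 1)) <|
    seq (op (.idxOne 12)) <| seq (loop (.idxNe 12 11) (seq (op (.add 0 0 6)) (op (.idxSucc 12)))) <|
    seq (op (.idxOne 12)) <| seq (loop (.idxNe 12 10) (seq (op (.sub 0 0 1)) (op (.idxSucc 12)))) <|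
    seq (op (.setZero 2)) <| seq (ite (.idxEq 9 4) (op (.sub 0 2 0)) skip) <|
    seq (op (.idxSucc 8)) <| ite (.nonneg 0) skip (op (.idxSucc 7)), ?_, ?_⟩
  · simp [NoQuery, hp₁, hp₂, hp₃]
  intro O L x n s h4 h6 h7 h8 hx
  simp only [ensures_seq_eq, ensures_op_eq]
  refine (hps₁ O s L n h6 h8).mono fun s₁ ⟨hZ₁, h9, hI₁⟩ =>
    (hps₂ O s₁ L n ?_ ?_).mono fun s₂ ⟨hZ₂, h10, hI₂⟩ =>
    (hps₃ O s₂ L n ?_ ?_).mono fun s₃ ⟨hZ₃, h11, hI₃⟩ =>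
    (ensures_repeat (y := x) (d := x) (k := 6) (m := (search L n).2.2) (by omega) (by omega)
      ?_ ?_ ?_ ?_).mono fun s₄ ⟨hI₄, hZ₄⟩ =>
    (ensures_repeat (y := 1) (d := -1) (k := 1) (m := (search L n).2.1) (by omega) (by omega)
      ?_ ?_ ?_ ?_).mono fun s₅ ⟨hI₅, hZ₅⟩ => ?_
  · rw [hI₁ _ (by omega) (by omega), h6]
  · rw [hI₁ _ (by omega) (by omega), h8]; rfl
  · rw [hI₂ _ (by omega) (by omega), hI₁ _ (by omega) (by omega), h6]
  · rw [hI₂ _ (by omega) (by omega), hI₁ _ (by omega) (by omega), h8]; rfl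
  · rintro s rfl; rfl
  · simp [Op.exec, hZ₃, hZ₂, hZ₁, hx]
  · simp [Op.exec]
  · simpa [Op.exec] using h11
  · intro s hs; simp [Op.exec, hs, sub_eq_add_neg]
  · simp [Op.exec, hZ₄]
  · simp [Op.exec]
  · simp [Op.exec, hI₄, hI₃, h10]
  have hI (i : ℕ) (hi : i < 9) : s₅.I i = s.I i := by
    rw [hI₅ i (by omega)]
    simp only [Op.exec]
    rw [Function.update_of_ne (by omega), hI₄ i (by omega)]
    simp only [Op.exec]
    rw [Function.update_of_ne (by omega), hI₃ i (by omega) (by omega),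
      hI₂ i (by omega) (by omega), hI₁ i (by omega) (by omega)]
  have h9' : s₅.I 9 = encode (search L n).1 + 1 := by
    rw [hI₅ 9 (by omega), ← h9, ← hI₂ 9 (by omega) (by omega), ← hI₃ 9 (by omega) (by omega)]
    simp [Op.exec, hI₄]
  have hZ0 : s₅.Z 0 = (search L n).2.2 * x - (search L n).2.1 := by
    simp [hZ₅, hZ₄, Op.exec]; ring
  have hZ6 : s₅.Z 6 = x := by
    simp [hZ₅, hZ₄, Op.exec, hZ₃, hZ₂, hZ₁, hx]
  have hsign : (ite (.idxEq 9 4) (op (.sub 0 2 0)) skip).Ensures O (fun s' => s'.I = s₅.I ∧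
      s'.Z 6 = x ∧ s'.Z 0 = (if (search L n).1 then 1 else -1) *
        ((search L n).2.2 * x - (search L n).2.1)) (Op.exec s₅ (.setZero 2)) := by
    refine ensures_ite (fun h => ensures_op ?_) fun h => ensures_skip ?_
    · simp only [Test.Holds, Op.exec, h9', hI 4 (by omega), h4] at h
      cases hb : (search L n).1
      · simp [Op.exec, hZ6, hZ0]
      · simp [hb] at h
    · simp only [Test.Holds, Op.exec, h9', hI 4 (by omega), h4] at h
      cases hb : (search L n).1
      · simp [hb] at h
      · simp [Op.exec, hZ6, hZ0]
  refine hsign.mono fun s₆ ⟨hI₆, hx₆, hZ₆⟩ => ensures_ite (fun h => ensures_skip ?_) fun h =>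
    ensures_op ?_
  · have hF : ¬ Found L x n := by
      rw [Found, ← hZ₆, not_lt]; exact h
    simp [hF, Op.exec, hI₆, hI, hx₆, h4, h6, h7, h8]
  · have hF : Found L x n := by
      rw [Found, ← hZ₆, ← not_le]; exact h
    simp [hF, Op.exec, hI₆, hI, hx₆, h4, h6, h7, h8]

end Prog

theorem exists_semiDecides_primeRootProblem :
    ∃ K ∈ OrderMachines, SemiDecides K ∅ primeRootProblem := by
  obtain ⟨p₁, hp₁, hps₁⟩ := Prog.exists_load
  obtain ⟨p₂, hp₂, hps₂⟩ := Prog.exists_readCodes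
  obtain ⟨p₃, hp₃, hps₃⟩ := Prog.exists_searchStep
  let last : Prog := .seq (.loop (.idxEq 7 4) p₃) (.seq (.op (.idxOne 0)) (.op (.setOne 0)))
  let P : Prog := .seq p₁ (.seq p₂ (.seq (.op (.idxOne 7)) (.seq (.op (.idxOne 8)) last)))
  have hP : P.NoQuery := by simp [P, last, Prog.NoQuery, hp₁, hp₂, hp₃]
  refine ⟨P.compile 0, hP.compile_mem_orderMachines, fun z hz => ?_⟩
  obtain ⟨s₁, he₁, h1⟩ := hps₁ ∅ z hz
  obtain ⟨s₂, he₂, ⟨h2, h3, h4⟩, h5⟩ := hps₂ ∅ z s₁ hz h1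
  set s₃ := Op.exec (Op.exec s₂ (.idxOne 7)) (.idxOne 8) with hs₃
  obtain ⟨e4, e6, e7, e8, eZ⟩ : s₃.I 4 = 1 ∧ s₃.I 6 = encode (z.map natCode) + 1 ∧ s₃.I 7 = 1 ∧
      s₃.I 8 = 1 ∧ s₃.Z 6 = s₂.Z 6 := by
    simp [hs₃, Op.exec, h3, h5]
  -- For a pair, the second entry is stored at position `2 + 3 + 1 = 6`.
  have hfound := exists_found_iff (z := z) (x := s₂.Z 6) fun hl => by
    have := h4 1 (by omega)
    rw [hl] at this
    exact this
  constructor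
  · intro hzA
    have hex := hfound.2 hzA
    classical
    obtain ⟨N, hN, hmin⟩ : ∃ N, Found (z.map natCode) (s₂.Z 6) N ∧
        ∀ i < N, ¬ Found (z.map natCode) (s₂.Z 6) i :=
      ⟨Nat.find hex, Nat.find_spec hex, fun _ => Nat.find_min hex⟩
    apply Prog.Ensures.haltsWith
    simp only [P, last, Prog.ensures_seq_eq, Prog.ensures_op_eq]
    refine ⟨s₁, he₁, s₂, he₂, ?_⟩
    change Prog.Ensures ∅ _ _ s₃
    -- The first success `N` bounds the loop: `N + 1` rounds, with `n` of them left.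
    refine (Prog.ensures_loop (fun n s => s.I 4 = 1 ∧ s.I 6 = encode (z.map natCode) + 1 ∧
      s.Z 6 = s₂.Z 6 ∧ (n = 0 → s.I 7 = 2) ∧
        (n ≠ 0 → s.I 7 = 1 ∧ ∃ i, s.I 8 = i + 1 ∧ i + n = N + 1)) ?_ ?_ (n := N + 1) ?_).mono ?_
    · rintro s ⟨h6, -, -, h7, -⟩
      simp [Test.Holds, h6, h7]
    · rintro n s ⟨h6, h7, h8, -, h9⟩
      obtain ⟨h9, i, h10, h11⟩ := h9 (by omega)
      refine ⟨by simp [Test.Holds, h6, h9], (hps₃ ∅ _ _ i s h6 h7 h9 h10 h8).mono ?_⟩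
      rintro s' ⟨h12, h13, h14, h15, h16⟩
      refine ⟨h12, h13, h16, ?_, fun hn => ⟨?_, i + 1, h15, by omega⟩⟩
      · rintro rfl
        obtain rfl : i = N := by omega
        exact h14.1 hN
      · exact h14.2 (hmin i (by omega))
    · exact ⟨e4, e6, eZ, by simp, fun _ => ⟨e7, 0, e8, by omega⟩⟩
    · intro s _
      simp [Op.exec]
  · intro hzA
    have hnot (n : ℕ) : ¬ Found (z.map natCode) (s₂.Z 6) n := fun h => hzA (hfound.1 ⟨n, h⟩)
    refine Prog.Diverges.not_halts (.seqRight he₁ (.seqRight he₂ (.seqRight (.op _ _)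
      (.seqRight (.op _ _) (.seqLeft (.loop {s | s.I 4 = 1 ∧
        s.I 6 = encode (z.map natCode) + 1 ∧ s.I 7 = 1 ∧ (∃ n, s.I 8 = n + 1) ∧ s.Z 6 = s₂.Z 6}
        ?_ _ ⟨e4, e6, e7, ⟨0, e8⟩, eZ⟩))))))
    rintro s ⟨h6, h7, h8, ⟨n, h9⟩, h10⟩
    obtain ⟨s', he, h11, h12, h13, h14, h15⟩ := hps₃ ∅ _ _ n s h6 h7 h8 h9 h10
    exact ⟨by simp [Test.Holds, h6, h8], s', ⟨h11, h12, h13.2 (hnot n), ⟨n + 1, h14⟩, h15⟩, he⟩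

/-! ### The hierarchy -/

/-- Level zero brings `HEq` under the general statements about levels. -/
theorem HProblem_zero (K : Machine) : HProblem K 0 = HEq := by
  simp [HProblem]

theorem instanceTuple_mem_iUnion_iff {K : Machine} (hK : K ∉ EqMachines) {j : ℕ} (hj : 1 ≤ j)
    {x : ℝ} : instanceTuple [(j : ℝ), x] (codeBits K) ∈ ⋃ i ∈ Set.Ici 1, HProblem K i ↔
      x ≠ sqrtPrime j := by
  simp only [mem_iUnion_HProblem, not_mem_HEq hK (List.cons_ne_nil _ _), false_or,
    instanceTuple_mem_PProblem, true_and]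
  constructor
  · rintro ⟨i, -, r, hr, h⟩
    simp only [List.cons.injEq, Nat.cast_inj, and_true] at h
    obtain ⟨rfl, rfl⟩ := h
    exact hr
  · intro h
    exact ⟨j, hj, x, h, rfl⟩

theorem strictlyEasier_of_subset {K : Machine} (hK : K ∉ EqMachines) {m : ℕ} {O : Set Tuple}
    (h₁ : HProblem K m ⊆ O) (h₂ : PProblem K (m + 1) ⊆ O)
    (h₃ : O ⊆ ⋃ i ∈ Set.Ici 1, HProblem K i) : StrictlyEasier (HProblem K m) O := by
  refine ⟨easier_of_subset hK h₁ h₃, not_easier_HProblem fun x => ⟨fun h => ?_, fun h => ?_⟩⟩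
  · exact (instanceTuple_mem_iUnion_iff hK (by omega)).1 (h₃ h)
  · exact h₂ (instanceTuple_mem_PProblem.2 ⟨rfl, x, h, rfl⟩)

theorem HProblem_subset_succ (K : Machine) (m : ℕ) : HProblem K m ⊆ HProblem K (m + 1) :=
  fun _ h => mem_HProblem.2 ((mem_HProblem.1 h).imp_right fun ⟨j, hj, h⟩ =>
    ⟨j, ⟨hj.1, by omega⟩, h⟩)

theorem HProblem_subset_iUnion (K : Machine) (m : ℕ) :
    HProblem K m ⊆ ⋃ i ∈ Set.Ici 1, HProblem K i :=
  fun _ h => mem_iUnion_HProblem.2 ((mem_HProblem.1 h).imp_right fun ⟨j, hj, h⟩ => ⟨j, hj.1, h⟩)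

theorem PProblem_subset_HProblem (K : Machine) (m : ℕ) :
    PProblem K (m + 1) ⊆ HProblem K (m + 1) :=
  fun _ h => mem_HProblem.2 (.inr ⟨m + 1, ⟨by omega, le_rfl⟩, h⟩)

theorem strictlyEasier_succ {K : Machine} (hK : K ∉ EqMachines) (m : ℕ) :
    StrictlyEasier (HProblem K m) (HProblem K (m + 1)) :=
  strictlyEasier_of_subset hK (HProblem_subset_succ K m) (PProblem_subset_HProblem K m)
    (HProblem_subset_iUnion K (m + 1))

theorem strictlyEasier_iUnion {K : Machine} (hK : K ∉ EqMachines) (m : ℕ) :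
    StrictlyEasier (HProblem K m) (⋃ i ∈ Set.Ici 1, HProblem K i) :=
  strictlyEasier_of_subset hK (HProblem_subset_iUnion K m)
    ((PProblem_subset_HProblem K m).trans (HProblem_subset_iUnion K (m + 1))) subset_rfl

/-- `HOrder` contains the halting inputs of some semi-deciding `K`, so the perturbation argument
with `k = 0` already separates it from `HEq`. -/
theorem HEq_strictlyEasier_HOrder : StrictlyEasier HEq HOrder := by
  obtain ⟨K, hK, hs⟩ := exists_semiDecides_primeRootProblem
  refine ⟨HEq_easier_HOrder, ?_⟩
  rw [← HProblem_zero K]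
  refine not_easier_HProblem fun x => ?_
  rw [HOrder, instanceTuple_mem_haltingProblem (List.cons_ne_nil _ _)]
  constructor
  · rintro ⟨M, -, h, hM⟩
    obtain rfl := codeBits_injective h
    obtain ⟨j, r, hj, hr, h⟩ := (hs.halts_iff (List.cons_ne_nil _ _)).1 hM
    simp only [List.cons.injEq, Nat.cast_inj, and_true] at h
    obtain ⟨rfl, rfl⟩ := h
    exact hr
  · intro h
    exact ⟨K, hK, rfl, (hs.halts_iff (List.cons_ne_nil _ _)).2 ⟨_, x, by omega, h, rfl⟩⟩

end AddBSS

theorem mainTheorem2 :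
    (∃ K ∈ AddBSS.OrderMachines, AddBSS.SemiDecides K ∅ AddBSS.primeRootProblem) ∧
    (∀ K ∈ AddBSS.OrderMachines, AddBSS.SemiDecides K ∅ AddBSS.primeRootProblem →
      AddBSS.StrictlyEasier AddBSS.HEq (AddBSS.HProblem K 1) ∧
      (∀ k : ℕ, 1 ≤ k →
        AddBSS.StrictlyEasier (AddBSS.HProblem K k) (AddBSS.HProblem K (k + 1))) ∧
      (∀ k : ℕ, 1 ≤ k →
        AddBSS.StrictlyEasier (AddBSS.HProblem K k)
          (⋃ i ∈ Set.Ici 1, AddBSS.HProblem K i)) ∧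
      AddBSS.Easier (⋃ i ∈ Set.Ici 1, AddBSS.HProblem K i) AddBSS.HOrder) ∧
    AddBSS.StrictlyEasier AddBSS.HEq AddBSS.HOrder := by
  refine ⟨AddBSS.exists_semiDecides_primeRootProblem, fun K hK hs => ?_,
    AddBSS.HEq_strictlyEasier_HOrder⟩
  have hE := AddBSS.not_mem_eqMachines hs
  refine ⟨?_, fun k _ => AddBSS.strictlyEasier_succ hE k,
    fun k _ => AddBSS.strictlyEasier_iUnion hE k, AddBSS.iUnion_HProblem_easier_HOrder hK hs hE⟩
  rw [← AddBSS.HProblem_zero K]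
  exact AddBSS.strictlyEasier_succ hE 0
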